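/- Let $(X,\mu)$ and $(Y,\nu)$ be $\sigma$-finite measure spaces, and let $f\in L^1(X,\mu)$, $g\in L^1(Y,\nu)$ with $f\ge 0$, $g\ge 0$ almost everywhere. Write $\mathbb R^+=[0,\infty)$ with Lebesgue measure, $\operatorname{supp} f=[f\ne 0]$, and $\chi_A$ for the indicator function of $A$. **Definitions.** The *distribution function* of $f$ is $D_f(t)=\mu([f>t])$, its *decreasing rearrangement* is $f^\downarrow(r)=\inf\{t\ge 0: D_f(t)\le r\}$, and its *Lorenz curve* is $L_f(t)=\int_0^t f^\downarrow(s)\,ds$; likewise for $g$. One says that $f$ *submajorizes* $g$, $f\succ_w g$, if $L_f(t)\ge L_g(t)$ for all $t>0$, and that $f$ *majorizes* $g$, $f\succ g$, if $f\succ_w g$ and $\int_X f\,d\mu=\int_Y g\,d\nu$. A *doubly substochastic (DSS) operator* from $(X,\mu)$ to $(Y,\nu)$ is a positive linear operator $T:L^\infty(X,\mu)\to L^\infty(Y,\nu)$ that is continuous for the weak* topologies ($\sigma(L^\infty,L^1)$), with $T(1)\le 1$ and $\int_Y T(h)\,d\nu\le\int_X h\,d\mu$ for all $0\le h\in L^1(X,\mu)\cap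 L^\infty(X,\mu)$. It is *doubly stochastic (DS)* if moreover $T(1)=1$ and the integral inequality is an equality for all such $h$. A DSS operator extends uniquely from $L^1\cap L^\infty$ to a bounded operator $L^1(X,\mu)\to L^1(Y,\nu)$, also denoted $T$. Its dual is the DSS operator $T^*$ from $(Y,\nu)$ to $(X,\mu)$ with $\int_Y h\,T(k)\,d\nu=\int_X T^*(h)\,k\,d\mu$ for all $k\in L^1(X,\mu)$ and $h\in L^\infty(Y,\nu)$. **Theorem (submajorization).** The following are equivalent: (a) $f\succ_w g$; (b) $\int_X\phi\circ f\,d\mu\ge\int_Y\phi\circ g\,d\nu$ (integrals in $[0,\infty]$) for all convex functions $\phi:\mathbb R^+\to\mathbb R^+$ with $\phi(0)=0$; (c) $\int_X (f-t)_+\,d\mu\ge\int_Y (g-t)_+\,d\nu$ for all $t\ge 0$; (d) there exists a DSS operator $T$ from $(X,\mu)$ to $(Y,\nu)$ such that $T(f)=g$. If these hold, there is a DSS operator $T$ from $(X,\mu)$ to $(Y,\nu)$ with $T(f)=g$, $T(\chi_{\operatorname{supp} f})\le\chi_{\operatorname{supp} g}$ and $T^*(\chi_{\operatorname{supp} g})\le\chi_{\operatorname{supp}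 f}$. **Theorem (majorization).** Assume in addition that $\int_X f\,d\mu=\int_Y g\,d\nu$. The following are equivalent: (a') $f\succ g$; (b') condition (b) holds; (c') condition (c) holds; (d') there exists a DS operator $S$ from $\mathbb R^+$ to $\mathbb R^+$ such that $S(f^\downarrow)=g^\downarrow$; (e') there exists a DSS operator $T$ from $(X,\mu)$ to $(Y,\nu)$ such that $T(f)=g$, $T(\chi_{\operatorname{supp} f})\le\chi_{\operatorname{supp} g}$ and $T^*(\chi_{\operatorname{supp} g})=\chi_{\operatorname{supp} f}$. If these hold, then $\mu(\operatorname{supp} f)\le\nu(\operatorname{supp} g)$. If $\mu(X)=\nu(Y)<\infty$, then (a')–(e') are further equivalent to (f') there exists a DS operator $T$ from $(X,\mu)$ to $(Y,\nu)$ such that $T(f)=g$. -/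

import Mathlib

open MeasureTheory Set
open scoped ENNReal

noncomputable section

namespace Majorization

variable {X Y : Type*} [MeasurableSpace X] [MeasurableSpace Y]

/-! ### Decreasing rearrangements and Lorenz curves -/

/-- The distribution function `D_f(t) = μ([f > t])`. -/
def distribution (μ : Measure X) (f : X → ℝ) (t : ℝ) : ℝ≥0∞ :=
  μ {x | t < f x}

/-- The decreasing rearrangement `f↓(r) = inf {t ≥ 0 : D_f(t) ≤ r}`, for `r ≥ 0`.
For integrable `f` the set is nonempty for every `r > 0`. -/
def rearrangement (μ : Measure X) (f : X → ℝ) (r : ℝ) : ℝ :=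
  sInf {t : ℝ | 0 ≤ t ∧ distribution μ f t ≤ ENNReal.ofReal r}

/-- The half-line `ℝ⁺ = [0, ∞)` with Lebesgue measure. -/
abbrev halfLine : Measure ℝ := volume.restrict (Ici 0)

/-- The Lorenz curve `L_f(t) = ∫₀ᵗ f↓(s) ds`. -/
def lorenz (μ : Measure X) (f : X → ℝ) (t : ℝ) : ℝ :=
  ∫ s in (0 : ℝ)..t, rearrangement μ f s

/-- Submajorization `f ≻_w g`. -/
def Submajorizes {μ : Measure X} {ν : Measure Y} (f : Lp ℝ 1 μ) (g : Lp ℝ 1 ν) : Prop :=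
  ∀ t : ℝ, 0 < t → lorenz ν g t ≤ lorenz μ f t

/-- Majorization `f ≻ g`. -/
def Majorizes {μ : Measure X} {ν : Measure Y} (f : Lp ℝ 1 μ) (g : Lp ℝ 1 ν) : Prop :=
  Submajorizes f g ∧ ∫ x, f x ∂μ = ∫ y, g y ∂ν

lemma rearrangement_set_nonempty {μ : Measure X} {f : X → ℝ} (hf : Integrable f μ)
    {r : ℝ} (hr : 0 < r) :
    {t : ℝ | 0 ≤ t ∧ distribution μ f t ≤ ENNReal.ofReal r}.Nonempty := by
  have hI : ∫⁻ x, ‖f x‖ₑ ∂μ ≠ ∞ := hf.2.ne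
  set C := (∫⁻ x, ‖f x‖ₑ ∂μ).toReal with hC
  have hC0 : 0 ≤ C := ENNReal.toReal_nonneg
  have ht : 0 < (C + 1) / r := by positivity
  refine ⟨(C + 1) / r, ht.le, ?_⟩
  have h1 := mul_meas_ge_le_lintegral₀ hf.1.enorm (ENNReal.ofReal ((C + 1) / r))
  have h2 : distribution μ f ((C + 1) / r) ≤
      μ {x | ENNReal.ofReal ((C + 1) / r) ≤ ‖f x‖ₑ} := by
    refine measure_mono fun x hx => ?_
    have hx' : (C + 1) / r < f x := hx
    show ENNReal.ofReal ((C + 1) / r) ≤ ‖f x‖ₑ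
    rw [← ofReal_norm]
    exact ENNReal.ofReal_le_ofReal (hx'.le.trans (le_abs_self _))
  have h3 : ENNReal.ofReal ((C + 1) / r) * distribution μ f ((C + 1) / r) ≤
      ENNReal.ofReal C := by
    rw [hC, ENNReal.ofReal_toReal hI]
    exact (mul_le_mul_right h2 _).trans h1
  have h4 : ENNReal.ofReal C ≤ ENNReal.ofReal ((C + 1) / r) * ENNReal.ofReal r := by
    rw [← ENNReal.ofReal_mul ht.le, div_mul_cancel₀ _ hr.ne']
    exact ENNReal.ofReal_le_ofReal (by linarith)
  exact (ENNReal.mul_le_mul_iff_right (ENNReal.ofReal_pos.2 ht).ne' ENNReal.ofReal_ne_top).1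
    (h3.trans h4)

lemma rearrangement_nonneg (μ : Measure X) (f : X → ℝ) (r : ℝ) : 0 ≤ rearrangement μ f r :=
  Real.sInf_nonneg fun _ ht => ht.1

lemma rearrangement_antitoneOn {μ : Measure X} {f : X → ℝ} (hf : Integrable f μ) :
    AntitoneOn (rearrangement μ f) (Ioi 0) := fun _ ha _ _ hab =>
  csInf_le_csInf ⟨0, fun _ ht => ht.1⟩ (rearrangement_set_nonempty hf ha)
    fun _ ht => ⟨ht.1, ht.2.trans (ENNReal.ofReal_le_ofReal hab)⟩

lemma halfLine_eq : halfLine = volume.restrict (Ioi (0 : ℝ)) :=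
  (Measure.restrict_congr_set Ioi_ae_eq_Ici).symm

/-- The decreasing rearrangement of an integrable function is integrable. -/
lemma integrable_rearrangement {μ : Measure X} {f : X → ℝ} (hf : Integrable f μ) :
    Integrable (rearrangement μ f) halfLine := by
  have hm : AEMeasurable (rearrangement μ f) halfLine := by
    rw [halfLine_eq]
    exact aemeasurable_restrict_of_antitoneOn measurableSet_Ioi (rearrangement_antitoneOn hf)
  refine ⟨hm.aestronglyMeasurable, ?_⟩
  rw [hasFiniteIntegral_iff_ofReal (Filter.Eventually.of_forall (rearrangement_nonneg μ f)),
    lintegral_eq_lintegral_meas_lt _ (Filter.Eventually.of_forall (rearrangement_nonneg μ f)) hm]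
  have hp : Integrable (fun x => max (f x) 0) μ := hf.pos_part
  have key : ∀ t ∈ Ioi (0 : ℝ), halfLine {r | t < rearrangement μ f r} ≤
      μ {x | t < max (f x) 0} := by
    intro t ht
    have hD : distribution μ f t = μ {x | t < max (f x) 0} := by
      unfold distribution
      congr 1
      ext x
      simp only [mem_ofPred_eq, lt_max_iff]
      exact ⟨Or.inl, fun h => h.elim id fun h => absurd h (not_lt.2 (le_of_lt ht))⟩
    rw [← hD]
    have hsub : {r | t < rearrangement μ f r} ∩ Ici 0 ⊆
        {r | 0 ≤ r ∧ ENNReal.ofReal r < distribution μ f t} := by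
      rintro r ⟨hr, hr0⟩
      refine ⟨hr0, not_le.1 fun hle => ?_⟩
      have hinf : rearrangement μ f r ≤ t :=
        csInf_le (⟨0, fun _ hs => hs.1⟩ : BddBelow {t : ℝ | 0 ≤ t ∧
          distribution μ f t ≤ ENNReal.ofReal r}) ⟨le_of_lt ht, hle⟩
      exact absurd hinf (not_le.2 hr)
    rw [Measure.restrict_apply' measurableSet_Ici]
    refine (measure_mono hsub).trans ?_
    by_cases htop : distribution μ f t = ∞
    · rw [htop]; exact le_top
    · have : {r | 0 ≤ r ∧ ENNReal.ofReal r < distribution μ f t} ⊆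
          Icc 0 (distribution μ f t).toReal := by
        rintro r ⟨h0, h1⟩
        exact ⟨h0, (ENNReal.ofReal_le_iff_le_toReal htop).1 h1.le⟩
      refine (measure_mono this).trans ?_
      rw [Real.volume_Icc, sub_zero, ENNReal.ofReal_toReal htop]
  refine (setLIntegral_mono' measurableSet_Ioi key).trans_lt ?_
  rw [← lintegral_eq_lintegral_meas_lt μ (f := fun x => max (f x) 0)
    (Filter.Eventually.of_forall fun x => le_max_right _ _) hp.1.aemeasurable]
  exact (hasFiniteIntegral_iff_ofReal
    (Filter.Eventually.of_forall fun x => le_max_right _ _)).1 hp.2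

/-- The decreasing rearrangement as an element of `L¹(ℝ⁺)`. -/
def rearrangementL1 {μ : Measure X} (f : Lp ℝ 1 μ) : Lp ℝ 1 halfLine :=
  (memLp_one_iff_integrable.2 (integrable_rearrangement (L1.integrable_coeFn f))).toLp
    (rearrangement μ f)

/-! ### Doubly substochastic operators -/

/-- The indicator function of a measurable set as an element of `L^∞`. -/
def chi (μ : Measure X) {s : Set X} (hs : MeasurableSet s) : Lp ℝ ∞ μ :=
  ((memLp_top_const (1 : ℝ)).indicator hs).toLp (s.indicator fun _ => (1 : ℝ))

/-- The constant function `1` in `L^∞`. -/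
def one (μ : Measure X) : Lp ℝ ∞ μ := chi μ MeasurableSet.univ

/-- The support `[f ≠ 0]` of an `L¹` function (well defined up to null sets). -/
def supp {μ : Measure X} (f : Lp ℝ 1 μ) : Set X := {x | f x ≠ 0}

lemma measurableSet_supp {μ : Measure X} (f : Lp ℝ 1 μ) : MeasurableSet (supp f) :=
  (Lp.stronglyMeasurable f).measurable (measurableSet_singleton 0).compl

/-- `χ_{supp f}` in `L^∞`. -/
def chiSupp {μ : Measure X} (f : Lp ℝ 1 μ) : Lp ℝ ∞ μ := chi μ (measurableSet_supp f)

/-- The weak* topology `σ(L^∞, L¹)` on `L^∞`: the coarsest topology that makes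
`h ↦ ∫ h k dμ` continuous for every `k ∈ L¹`. -/
abbrev weakStar (μ : Measure X) : TopologicalSpace (Lp ℝ ∞ μ) :=
  TopologicalSpace.induced (fun h (k : Lp ℝ 1 μ) => ∫ x, h x * k x ∂μ) Pi.topologicalSpace

/-- A doubly substochastic operator from `(X, μ)` to `(Y, ν)`. -/
structure DSS (μ : Measure X) (ν : Measure Y) where
  /-- the operator on `L^∞` -/
  op : Lp ℝ ∞ μ →ₗ[ℝ] Lp ℝ ∞ ν
  positive : ∀ h, 0 ≤ h → 0 ≤ op h
  weakStar_continuous : @Continuous _ _ (weakStar μ) (weakStar ν) op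
  subunital : op (one μ) ≤ one ν
  integral_le : ∀ h : Lp ℝ ∞ μ, 0 ≤ h → Integrable h μ →
    ∫⁻ y, ENNReal.ofReal (op h y) ∂ν ≤ ∫⁻ x, ENNReal.ofReal (h x) ∂μ

/-- A doubly substochastic operator is doubly stochastic if it is unital and
integral-preserving. -/
def DSS.IsDS {μ : Measure X} {ν : Measure Y} (T : DSS μ ν) : Prop :=
  T.op (one μ) = one ν ∧
    ∀ h : Lp ℝ ∞ μ, 0 ≤ h → Integrable h μ →
      ∫⁻ y, ENNReal.ofReal (T.op h y) ∂ν = ∫⁻ x, ENNReal.ofReal (h x) ∂μ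

/-! ### The extension of a doubly substochastic operator to `L¹` -/

/-- `L¹ ∩ L^∞` as a subspace of `L^∞`. -/
def LOneInf (μ : Measure X) : Submodule ℝ (Lp ℝ ∞ μ) where
  carrier := {h | Integrable h μ}
  add_mem' {a b} ha hb := (Integrable.add ha hb).congr (Lp.coeFn_add a b).symm
  zero_mem' := (integrable_zero X ℝ μ).congr (Lp.coeFn_zero ℝ ∞ μ).symm
  smul_mem' c a ha := (Integrable.smul c ha).congr (Lp.coeFn_smul c a).symm

lemma LOneInf.integrable {μ : Measure X} (h : LOneInf μ) : Integrable (h : Lp ℝ ∞ μ) μ := h.2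

/-- The inclusion `L¹ ∩ L^∞ → L¹`. -/
def LOneInf.toL1 (μ : Measure X) : LOneInf μ →ₗ[ℝ] Lp ℝ 1 μ where
  toFun h := Integrable.toL1 (h : Lp ℝ ∞ μ) (LOneInf.integrable h)
  map_add' a b := by
    refine Eq.trans ?_ (Integrable.toL1_add _ _ (LOneInf.integrable a) (LOneInf.integrable b))
    exact (Integrable.toL1_eq_toL1_iff _ _ _ _).2 (Lp.coeFn_add _ _)
  map_smul' c a := by
    refine Eq.trans ?_ (Integrable.toL1_smul _ (LOneInf.integrable a) c)
    exact (Integrable.toL1_eq_toL1_iff _ _ _ _).2 (Lp.coeFn_smul _ _)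

lemma LOneInf.denseRange_toL1 (μ : Measure X) : DenseRange (LOneInf.toL1 μ) := by
  refine (Lp.simpleFunc.dense (E := ℝ) (μ := μ) ENNReal.one_ne_top).mono ?_
  rintro k hk
  set s : Lp.simpleFunc ℝ 1 μ := ⟨k, hk⟩
  have hs : Lp.simpleFunc.toSimpleFunc s =ᵐ[μ] k := Lp.simpleFunc.toSimpleFunc_eq_toFun s
  have hinf : MemLp (Lp.simpleFunc.toSimpleFunc s) ∞ μ := SimpleFunc.memLp_top _ μ
  have hint : Integrable (hinf.toLp _) μ :=
    ((L1.integrable_coeFn k).congr hs.symm).congr hinf.coeFn_toLp.symm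
  refine ⟨⟨hinf.toLp _, hint⟩, ?_⟩
  refine Lp.ext ?_
  exact (Integrable.coeFn_toL1 hint).trans (hinf.coeFn_toLp.trans hs)

namespace DSS

variable {μ : Measure X} {ν : Measure Y} (T : DSS μ ν)

lemma lintegral_enorm_le (h : LOneInf μ) :
    ∫⁻ y, ‖T.op h y‖ₑ ∂ν ≤ ∫⁻ x, ‖(h : Lp ℝ ∞ μ) x‖ₑ ∂μ := by
  have hle : |T.op h| ≤ T.op |(h : Lp ℝ ∞ μ)| := by
    refine abs_le'.2 ⟨?_, ?_⟩
    · rw [← sub_nonneg, ← map_sub]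
      exact T.positive _ (sub_nonneg.2 (le_abs_self _))
    · rw [← sub_nonneg, ← map_neg, ← map_sub]
      exact T.positive _ (sub_nonneg.2 (neg_le_abs _))
  have habs : Integrable (|(h : Lp ℝ ∞ μ)| : Lp ℝ ∞ μ) μ :=
    (Integrable.abs h.2).congr (Lp.coeFn_abs _).symm
  calc ∫⁻ y, ‖T.op h y‖ₑ ∂ν
      ≤ ∫⁻ y, ENNReal.ofReal (T.op |(h : Lp ℝ ∞ μ)| y) ∂ν := by
        refine lintegral_mono_ae ?_
        filter_upwards [(Lp.coeFn_le _ _).2 hle, Lp.coeFn_abs (T.op h)] with y h1 h2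
        rw [← ofReal_norm, Real.norm_eq_abs, ← h2]
        exact ENNReal.ofReal_le_ofReal h1
    _ ≤ ∫⁻ x, ENNReal.ofReal ((|(h : Lp ℝ ∞ μ)| : Lp ℝ ∞ μ) x) ∂μ :=
        T.integral_le _ (abs_nonneg _) habs
    _ = ∫⁻ x, ‖(h : Lp ℝ ∞ μ) x‖ₑ ∂μ := by
        refine lintegral_congr_ae ?_
        filter_upwards [Lp.coeFn_abs (h : Lp ℝ ∞ μ)] with x hx
        rw [hx, ← ofReal_norm, Real.norm_eq_abs]

lemma integrable_op (h : LOneInf μ) : Integrable (T.op h) ν :=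
  ⟨Lp.aestronglyMeasurable _, (T.lintegral_enorm_le h).trans_lt (LOneInf.integrable h).hasFiniteIntegral⟩

/-- The restriction of the operator to `L¹ ∩ L^∞`, with values in `L¹`. -/
def opL1 : LOneInf μ →ₗ[ℝ] Lp ℝ 1 ν :=
  LOneInf.toL1 ν ∘ₗ (T.op.restrict (p := LOneInf μ) (q := LOneInf ν) fun h hh => T.integrable_op ⟨h, hh⟩)

lemma norm_opL1_le (h : LOneInf μ) : ‖T.opL1 h‖ ≤ 1 * ‖LOneInf.toL1 μ h‖ := by
  rw [one_mul]
  have h1 : ‖T.opL1 h‖ = (∫⁻ y, ‖T.op h y‖ₑ ∂ν).toReal := by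
    refine (Integrable.norm_toL1_eq_lintegral_norm _ (T.integrable_op h)).trans ?_
    simp only [ofReal_norm]
  have h2 : ‖LOneInf.toL1 μ h‖ = (∫⁻ x, ‖(h : Lp ℝ ∞ μ) x‖ₑ ∂μ).toReal := by
    refine (Integrable.norm_toL1_eq_lintegral_norm _ (LOneInf.integrable h)).trans ?_
    simp only [ofReal_norm]
  rw [h1, h2]
  exact ENNReal.toReal_mono (LOneInf.integrable h).hasFiniteIntegral.ne (T.lintegral_enorm_le h)

/-- The extension of a doubly substochastic operator from `L¹ ∩ L^∞` to a bounded operator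
`L¹(X, μ) → L¹(Y, ν)`. -/
def onL1 : Lp ℝ 1 μ →L[ℝ] Lp ℝ 1 ν := T.opL1.extendOfNorm (LOneInf.toL1 μ)

/-- `onL1` does extend the operator ... -/
lemma onL1_ae_eq (h : Lp ℝ ∞ μ) (k : Lp ℝ 1 μ) (hk : h =ᵐ[μ] k) : T.onL1 k =ᵐ[ν] T.op h := by
  have hh : Integrable h μ := (L1.integrable_coeFn k).congr hk.symm
  have hk' : k = LOneInf.toL1 μ ⟨h, hh⟩ :=
    Lp.ext (hk.symm.trans (Integrable.coeFn_toL1 hh).symm)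
  rw [hk', onL1, LinearMap.extendOfNorm_eq (LOneInf.denseRange_toL1 μ) ⟨1, T.norm_opL1_le⟩]
  exact Integrable.coeFn_toL1 (T.integrable_op ⟨h, hh⟩)

/-- ... and it is the only bounded operator that does. -/
lemma onL1_unique (S : Lp ℝ 1 μ →L[ℝ] Lp ℝ 1 ν)
    (hS : ∀ (h : Lp ℝ ∞ μ) (k : Lp ℝ 1 μ), h =ᵐ[μ] k → S k =ᵐ[ν] T.op h) : S = T.onL1 := by
  refine ContinuousLinearMap.coeFn_injective
    ((LOneInf.denseRange_toL1 μ).equalizer S.continuous T.onL1.continuous (funext fun h => ?_))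
  have hk := (Integrable.coeFn_toL1 (LOneInf.integrable h)).symm
  exact Lp.ext ((hS h (LOneInf.toL1 μ h) hk).trans (T.onL1_ae_eq h (LOneInf.toL1 μ h) hk).symm)

/-- `S` is the dual `T*` of `T`: `∫ h · T(k) dν = ∫ T*(h) · k dμ` for `k ∈ L¹(X, μ)` and
`h ∈ L^∞(Y, ν)`. -/
def IsDual (S : DSS ν μ) : Prop :=
  ∀ (k : Lp ℝ 1 μ) (h : Lp ℝ ∞ ν), ∫ y, h y * T.onL1 k y ∂ν = ∫ x, S.op h x * k x ∂μ

end DSS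

end Majorization

end

open Majorization

/-!
The operators come from measures on product spaces. A measure `π` on `X × Y` with marginals at most
`μ` and `ν` (`IsSubcoupling`) defines a doubly substochastic operator `IsSubcoupling.dss`: the image
of `h` is the density of the second marginal of `h(x) dπ(x, y)`. Exchanging the two coordinates
gives the dual operator, full marginals give a doubly stochastic operator, and no compactness
argument is needed anywhere, because every coupling below is explicit.

The conditions for submajorization are linked in a circle.

* An operator with `T f = g` satisfies Jensen's inequality `φ ∘ T f ≤ T (φ ∘ f)`, because `φ` is a
  countable supremum of affine functions `s ↦ a s - b` with `b ≥ 0`. Integrating gives the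
  inequality for convex functions (`DSS.lintegral_convex_le`).
* The functions `s ↦ (s - t)₊` are convex, so the excess integrals `∫ (f - t)₊` dominate those
  of `g`.
* A function and its rearrangement have the same excess integrals, and the Lorenz curve is recovered
  as `L_f(r) = inf_{t ≥ 0} (r t + ∫ (f - t)₊)`
  (`submajorizes_of_integral_max_sub_le`).
* If `L_g ≤ L_f`, the operator is a composition `f ↦ f↓ ↦ k ↦ g↓ ↦ g`
  (`exists_dss_of_submajorizes`).
  The outer two steps come from a coupling of `μ` on `supp f` with Lebesgue measure on
  `[0, μ(supp f))` on which `f(x) = f↓(r)` (`exists_rearrangement_coupling`): each level set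
  `[f = t]` is spread over the interval of the corresponding length. These couplings live over the
  supports, which gives the bounds on `T(χ_{supp f})` and `T*(χ_{supp g})`. The step from `f↓` to
  some `k ≥ g↓` comes from the exchange coupling (`exists_exchange_coupling`): the inequality of the
  Lorenz curves says exactly that the excess `(f↓ - g↓)₊` can be transported to the deficit
  `(g↓ - f↓)₊` by a plan `γ` moving mass to the right, and exchanging the amount
  `dγ(x, y) / (f↓(x) - f↓(y))` of Lebesgue measure between `x` and `y` lowers the first average and
  raises the second one as required. Both marginals of this coupling are Lebesgue measure. The step
  from `k` to `g↓` is multiplication by `g↓ / k` (`exists_damping`).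

If `f` and `g` have the same integral, then `k = g↓`, and the exchange coupling is a doubly
stochastic operator from `f↓` to `g↓` (`exists_ds_rearrangement`). Moreover
`∫ f T*(χ_{supp g}) = ∫ g = ∫ f` forces `T*(χ_{supp g}) = 1` on `supp f`
(`DSS.dual_chiSupp_eq`), and then the integral inequality for `T*` compares the measures of the
supports. On finite measure spaces of equal mass, adding the operator of rank one
`h ↦ (∫ q h / ∫ q) p` with the defects `p = 1 - T(1)` and `q = 1 - T*(1)` makes `T` doubly
stochastic without changing `T f`, since `q` vanishes on `supp f` (`exists_ds_completion`).
-/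

noncomputable section

namespace Majorization

variable {X Y : Type*} [MeasurableSpace X] [MeasurableSpace Y]

/-! ### Essentially bounded functions and maps that do not increase measure -/

section Pullback

variable {Z : Type*} [MeasurableSpace Z] {π : Measure Z} {ν : Measure Y} {s : Z → Y}

lemma Linfty_ae_bound {μ : Measure X} (h : Lp ℝ ∞ μ) : ∀ᵐ x ∂μ, ‖h x‖ ≤ ‖h‖ := by
  have h1 := enorm_ae_le_eLpNormEssSup (h : X → ℝ) μ
  filter_upwards [h1] with x hx
  have h2 : eLpNorm h ∞ μ ≠ ∞ := Lp.eLpNorm_ne_top h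
  rw [← eLpNorm_exponent_top] at hx
  rw [Lp.norm_def, ← toReal_enorm]
  exact ENNReal.toReal_mono h2 hx

lemma chi_ae_eq (μ : Measure X) {A : Set X} (hA : MeasurableSet A) :
    chi μ hA =ᵐ[μ] A.indicator fun _ => (1 : ℝ) := MemLp.coeFn_toLp _

lemma one_ae_eq (μ : Measure X) : one μ =ᵐ[μ] fun _ => (1 : ℝ) := by
  have h := chi_ae_eq μ MeasurableSet.univ
  rwa [indicator_univ] at h

lemma ae_eq_comp_of_map_le (hs : Measurable s) (hle : π.map s ≤ ν) {δ : Type*} {h h' : Y → δ}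
    (e : h =ᵐ[ν] h') : h ∘ s =ᵐ[π] h' ∘ s :=
  Measure.QuasiMeasurePreserving.ae_eq_comp
    ⟨hs, Measure.absolutelyContinuous_of_le hle⟩ e

lemma ae_comp_of_map_le (hs : Measurable s) (hle : π.map s ≤ ν) {p : Y → Prop}
    (e : ∀ᵐ y ∂ν, p y) : ∀ᵐ z ∂π, p (s z) :=
  Measure.QuasiMeasurePreserving.ae
    ⟨hs, Measure.absolutelyContinuous_of_le hle⟩ e

lemma integrable_comp_of_map_le (hs : Measurable s) (hle : π.map s ≤ ν) {k : Y → ℝ}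
    (hk : Integrable k ν) : Integrable (fun z => k (s z)) π :=
  (hk.mono_measure hle).comp_measurable hs

lemma aestronglyMeasurable_comp_of_map_le (hs : Measurable s) (hle : π.map s ≤ ν) {k : Y → ℝ}
    (hk : AEStronglyMeasurable k ν) : AEStronglyMeasurable (fun z => k (s z)) π :=
  (hk.mono_measure hle).comp_measurable hs

lemma continuous_integral_mul_comp (hs : Measurable s) (hle : π.map s ≤ ν) {w : Z → ℝ}
    (hw : AEStronglyMeasurable w π) {C : ℝ} (hC : ∀ᵐ z ∂π, ‖w z‖ ≤ C) :
    Continuous fun k : Lp ℝ 1 ν => ∫ z, w z * k (s z) ∂π := by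
  have hint : ∀ k : Lp ℝ 1 ν, Integrable (fun z => w z * k (s z)) π := fun k =>
    (integrable_comp_of_map_le hs hle (L1.integrable_coeFn k)).bdd_mul hw hC
  refine LipschitzWith.continuous (K := (max C 0).toNNReal) (LipschitzWith.of_dist_le_mul ?_)
  intro k k'
  rw [Real.coe_toNNReal _ (le_max_right _ _), L1.dist_eq_integral_dist, Real.dist_eq,
    ← integral_sub (hint k) (hint k')]
  have hd : Integrable (fun y => dist (k y) (k' y)) ν := by
    simp only [Real.dist_eq]
    exact ((L1.integrable_coeFn k).sub (L1.integrable_coeFn k')).abs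
  calc |∫ z, w z * k (s z) - w z * k' (s z) ∂π|
      ≤ ∫ z, |w z * k (s z) - w z * k' (s z)| ∂π := abs_integral_le_integral_abs
    _ ≤ ∫ z, max C 0 * dist (k (s z)) (k' (s z)) ∂π := by
        refine integral_mono_ae ((hint k).sub (hint k')).abs
          ((integrable_comp_of_map_le hs hle hd).const_mul _) ?_
        filter_upwards [hC] with z hz
        simp only [← mul_sub, abs_mul, Real.dist_eq]
        exact mul_le_mul_of_nonneg_right (hz.trans (le_max_left _ _)) (abs_nonneg _)
    _ = max C 0 * ∫ y, dist (k y) (k' y) ∂(π.map s) := by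
        rw [integral_const_mul, integral_map hs.aemeasurable (hd.1.mono_measure hle)]
    _ ≤ max C 0 * ∫ y, dist (k y) (k' y) ∂ν := by
        refine mul_le_mul_of_nonneg_left ?_ (le_max_right _ _)
        exact integral_mono_measure hle (Filter.Eventually.of_forall fun _ => dist_nonneg) hd

end Pullback

/-- Two elements of `L^∞` agree if they have the same integrals over sets of finite measure. -/
lemma Linfty_ext {ν : Measure Y} [SigmaFinite ν] {w w' : Lp ℝ ∞ ν}
    (h : ∀ B, MeasurableSet B → ν B < ∞ → ∫ y in B, w y ∂ν = ∫ y in B, w' y ∂ν) : w = w' := by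
  have hi : ∀ (w : Lp ℝ ∞ ν) B, MeasurableSet B → ν B < ∞ → IntegrableOn w B ν :=
    fun w B _ hB => by
      refine Measure.integrableOn_of_bounded hB.ne (Lp.aestronglyMeasurable w) (M := ‖w‖) ?_
      exact ae_restrict_of_ae (Linfty_ae_bound w)
  exact Lp.ext (ae_eq_of_forall_setIntegral_eq_of_sigmaFinite (hi w) (hi w') h)

lemma integrableOn_Linfty {ν : Measure Y} (w : Lp ℝ ∞ ν) {B : Set Y} (hB : ν B < ∞) :
    IntegrableOn w B ν :=
  Measure.integrableOn_of_bounded hB.ne (Lp.aestronglyMeasurable w) (M := ‖w‖)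
    (ae_restrict_of_ae (Linfty_ae_bound w))

/-! ### The operator of a subcoupling -/

/-- A subcoupling of `μ` and `ν`: a measure on the product whose marginals are at most
`μ` and `ν`. -/
structure IsSubcoupling (π : Measure (X × Y)) (μ : Measure X) (ν : Measure Y) : Prop where
  fst_le : π.map Prod.fst ≤ μ
  snd_le : π.map Prod.snd ≤ ν

namespace IsSubcoupling

variable {π : Measure (X × Y)} {μ : Measure X} {ν : Measure Y}

lemma swap (hπ : IsSubcoupling π μ ν) : IsSubcoupling (π.map Prod.swap) ν μ := by
  constructor
  · rw [Measure.map_map measurable_fst measurable_swap]; exact hπ.snd_le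
  · rw [Measure.map_map measurable_snd measurable_swap]; exact hπ.fst_le

/-- The density of the second marginal of `h(x) dπ(x, y)`, which is at most `C ν`. -/
lemma exists_density_of_nonneg [SigmaFinite ν] (hπ : IsSubcoupling π μ ν) {h : X → ℝ}
    {C : ℝ} (hC : ∀ᵐ x ∂μ, ‖h x‖ ≤ C) :
    ∃ w : Lp ℝ ∞ ν, 0 ≤ w ∧ ∀ B, MeasurableSet B →
      ∫⁻ y in B, ENNReal.ofReal (w y) ∂ν = ∫⁻ z in Prod.snd ⁻¹' B, ENNReal.ofReal (h z.1) ∂π := by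
  set ρ : Measure Y := (π.withDensity fun z => ENNReal.ofReal (h z.1)).map Prod.snd with hρ
  have hρB : ∀ B, MeasurableSet B →
      ρ B = ∫⁻ z in Prod.snd ⁻¹' B, ENNReal.ofReal (h z.1) ∂π := fun B hB => by
    rw [hρ, Measure.map_apply measurable_snd hB, withDensity_apply _ (measurable_snd hB)]
  have hle : ∀ B, MeasurableSet B → ρ B ≤ ENNReal.ofReal C * ν B := fun B hB => by
    rw [hρB B hB]
    calc ∫⁻ z in Prod.snd ⁻¹' B, ENNReal.ofReal (h z.1) ∂π
        ≤ ∫⁻ z in Prod.snd ⁻¹' B, ENNReal.ofReal C ∂π := by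
          refine lintegral_mono_ae (ae_restrict_of_ae ?_)
          filter_upwards [ae_comp_of_map_le measurable_fst hπ.fst_le hC] with z hz
          exact ENNReal.ofReal_le_ofReal ((le_abs_self _).trans hz)
      _ = ENNReal.ofReal C * π.map Prod.snd B := by
          rw [setLIntegral_const, Measure.map_apply measurable_snd hB]
      _ ≤ _ := by exact mul_le_mul_right (hπ.snd_le B) _
  have hle' : ρ ≤ (C.toNNReal • ν : Measure Y) := Measure.le_iff.2 fun B hB => hle B hB
  have : SigmaFinite ρ := Measure.sigmaFinite_of_le _ hle'
  have hac : ρ ≪ ν := Measure.AbsolutelyContinuous.mk fun B hB h0 =>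
    le_antisymm ((hle B hB).trans (by simp [h0])) zero_le
  have hW : ∀ B, ∫⁻ y in B, ρ.rnDeriv ν y ∂ν = ρ B := Measure.setLIntegral_rnDeriv hac
  have hbd : ρ.rnDeriv ν ≤ᵐ[ν] fun _ => ENNReal.ofReal C := by
    refine ae_le_of_forall_setLIntegral_le_of_sigmaFinite (Measure.measurable_rnDeriv _ _) ?_
    intro B hB _
    rw [hW, setLIntegral_const]
    exact hle B hB
  have hmem : MemLp (fun y => (ρ.rnDeriv ν y).toReal) ∞ ν := by
    refine memLp_top_of_bound (Measure.measurable_rnDeriv _ _).ennreal_toReal.aestronglyMeasurable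
      (max C 0) ?_
    filter_upwards [hbd] with y hy
    rw [Real.norm_of_nonneg ENNReal.toReal_nonneg]
    exact ENNReal.toReal_le_of_le_ofReal (le_max_right _ _)
      (hy.trans (ENNReal.ofReal_le_ofReal (le_max_left _ _)))
  refine ⟨hmem.toLp _, (Lp.coeFn_nonneg _).1 ?_, fun B hB => ?_⟩
  · filter_upwards [hmem.coeFn_toLp] with y hy
    rw [hy]; exact ENNReal.toReal_nonneg
  · rw [← hρB B hB, ← hW B]
    refine lintegral_congr_ae (ae_restrict_of_ae ?_)
    filter_upwards [hbd, hmem.coeFn_toLp] with y hy hy'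
    rw [hy', ENNReal.ofReal_toReal (hy.trans_lt ENNReal.ofReal_lt_top).ne]

lemma measure_snd_lt_top (hπ : IsSubcoupling π μ ν) {B : Set Y} (hB : MeasurableSet B)
    (hfin : ν B < ∞) : π (Prod.snd ⁻¹' B) < ∞ := by
  rw [← Measure.map_apply measurable_snd hB]
  exact (hπ.snd_le B).trans_lt hfin

lemma setIntegral_density {h : X → ℝ}
    (hm : Measurable h) (h0 : ∀ x, 0 ≤ h x) {w : Lp ℝ ∞ ν} (hw : 0 ≤ w) {B : Set Y}
    (hwB : ∫⁻ y in B, ENNReal.ofReal (w y) ∂ν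
      = ∫⁻ z in Prod.snd ⁻¹' B, ENNReal.ofReal (h z.1) ∂π) :
    ∫ y in B, w y ∂ν = ∫ z in Prod.snd ⁻¹' B, h z.1 ∂π := by
  rw [integral_eq_lintegral_of_nonneg_ae (ae_restrict_of_ae ((Lp.coeFn_nonneg w).2 hw))
    (Lp.aestronglyMeasurable w).restrict, hwB, integral_eq_lintegral_of_nonneg_ae
    (f := fun z : X × Y => h z.1) (Filter.Eventually.of_forall fun z => h0 z.1)
    (hm.comp measurable_fst).aestronglyMeasurable]

lemma integrableOn_fst (hπ : IsSubcoupling π μ ν) (h : Lp ℝ ∞ μ) {B : Set Y}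
    (hB : MeasurableSet B) (hfin : ν B < ∞) :
    IntegrableOn (fun z => h z.1) (Prod.snd ⁻¹' B) π :=
  Measure.integrableOn_of_bounded (hπ.measure_snd_lt_top hB hfin).ne
    (aestronglyMeasurable_comp_of_map_le measurable_fst hπ.fst_le (Lp.aestronglyMeasurable h))
    (M := ‖h‖)
    (ae_restrict_of_ae (ae_comp_of_map_le measurable_fst hπ.fst_le (Linfty_ae_bound h)))

lemma exists_density [SigmaFinite ν] (hπ : IsSubcoupling π μ ν) (h : Lp ℝ ∞ μ) :
    ∃ w : Lp ℝ ∞ ν, ∀ B, MeasurableSet B → ν B < ∞ →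
      ∫ y in B, w y ∂ν = ∫ z in Prod.snd ⁻¹' B, h z.1 ∂π := by
  have hm : Measurable h := (Lp.stronglyMeasurable h).measurable
  have hb := Linfty_ae_bound h
  have key : ∀ k : X → ℝ, Measurable k → (∀ x, 0 ≤ k x) → (∀ x, ‖k x‖ ≤ ‖h x‖) →
      ∃ w : Lp ℝ ∞ ν, ∀ B, MeasurableSet B → ν B < ∞ →
        IntegrableOn (fun z => k z.1) (Prod.snd ⁻¹' B) π ∧
        ∫ y in B, w y ∂ν = ∫ z in Prod.snd ⁻¹' B, k z.1 ∂π := by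
    intro k hk k0 hkh
    obtain ⟨w, hw0, hw⟩ := hπ.exists_density_of_nonneg (h := k) (C := ‖h‖)
      (by filter_upwards [hb] with x hx using (hkh x).trans hx)
    refine ⟨w, fun B hB hfin => ⟨?_, setIntegral_density hk k0 hw0 (hw B hB)⟩⟩
    exact Integrable.mono (hπ.integrableOn_fst h hB hfin)
      (hk.comp measurable_fst).aestronglyMeasurable
      (Filter.Eventually.of_forall fun z : X × Y => hkh z.1)
  obtain ⟨wp, hwp⟩ := key (fun x => max (h x) 0) (hm.max measurable_const)
    (fun x => le_max_right _ _) fun x => by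
      rw [Real.norm_of_nonneg (le_max_right _ _)]; exact max_le (le_abs_self _) (abs_nonneg _)
  obtain ⟨wn, hwn⟩ := key (fun x => max (-h x) 0) (hm.neg.max measurable_const)
    (fun x => le_max_right _ _) fun x => by
      rw [Real.norm_of_nonneg (le_max_right _ _)]; exact max_le (neg_le_abs _) (abs_nonneg _)
  refine ⟨wp - wn, fun B hB hfin => ?_⟩
  have e : ∫ y in B, (wp - wn : Lp ℝ ∞ ν) y ∂ν = ∫ y in B, (wp y - wn y) ∂ν :=
    integral_congr_ae (ae_restrict_of_ae (Lp.coeFn_sub _ _))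
  rw [e, integral_sub (integrableOn_Linfty wp hfin) (integrableOn_Linfty wn hfin),
    (hwp B hB hfin).2, (hwn B hB hfin).2, ← integral_sub (hwp B hB hfin).1 (hwn B hB hfin).1]
  refine integral_congr_ae (Filter.Eventually.of_forall fun z : X × Y => ?_)
  exact max_zero_sub_max_neg_zero_eq_self (h z.1)

variable [SigmaFinite ν]

/-- The operator `L^∞(μ) → L^∞(ν)` of a subcoupling `π`: the image of `h` is the density with
respect to `ν` of the second marginal of `h(x) dπ(x, y)`. -/
def op (hπ : IsSubcoupling π μ ν) : Lp ℝ ∞ μ →ₗ[ℝ] Lp ℝ ∞ ν where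
  toFun h := (hπ.exists_density h).choose
  map_add' a b := by
    refine Linfty_ext fun B hB hfin => ?_
    rw [(hπ.exists_density (a + b)).choose_spec B hB hfin,
      integral_congr_ae (ae_restrict_of_ae (Lp.coeFn_add (hπ.exists_density a).choose
        (hπ.exists_density b).choose)),
      integral_add' (integrableOn_Linfty _ hfin) (integrableOn_Linfty _ hfin),
      (hπ.exists_density a).choose_spec B hB hfin, (hπ.exists_density b).choose_spec B hB hfin,
      ← integral_add (hπ.integrableOn_fst a hB hfin) (hπ.integrableOn_fst b hB hfin)]
    exact integral_congr_ae (ae_restrict_of_ae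
      (ae_eq_comp_of_map_le measurable_fst hπ.fst_le (Lp.coeFn_add a b)))
  map_smul' c a := by
    refine Linfty_ext fun B hB hfin => ?_
    rw [(hπ.exists_density (c • a)).choose_spec B hB hfin,
      integral_congr_ae (ae_restrict_of_ae (Lp.coeFn_smul (RingHom.id ℝ c)
        (hπ.exists_density a).choose))]
    simp only [Pi.smul_apply, RingHom.id_apply]
    rw [integral_smul, (hπ.exists_density a).choose_spec B hB hfin, ← integral_smul]
    exact integral_congr_ae (ae_restrict_of_ae
      (ae_eq_comp_of_map_le measurable_fst hπ.fst_le (Lp.coeFn_smul c a)))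

lemma setIntegral_op (hπ : IsSubcoupling π μ ν) (h : Lp ℝ ∞ μ) {B : Set Y}
    (hB : MeasurableSet B) (hfin : ν B < ∞) :
    ∫ y in B, hπ.op h y ∂ν = ∫ z in Prod.snd ⁻¹' B, h z.1 ∂π :=
  (hπ.exists_density h).choose_spec B hB hfin

/-- For nonnegative functions, the integral formula holds over sets of infinite measure as well. -/
lemma op_nonneg_and_setLIntegral (hπ : IsSubcoupling π μ ν) {h : Lp ℝ ∞ μ} (h0 : 0 ≤ h) :
    0 ≤ hπ.op h ∧ ∀ B, MeasurableSet B → ∫⁻ y in B, ENNReal.ofReal (hπ.op h y) ∂ν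
      = ∫⁻ z in Prod.snd ⁻¹' B, ENNReal.ofReal (h z.1) ∂π := by
  have hm : Measurable h := (Lp.stronglyMeasurable h).measurable
  have e : (fun x => max (h x) 0) =ᵐ[μ] h := by
    filter_upwards [(Lp.coeFn_nonneg h).2 h0] with x hx using max_eq_left hx
  obtain ⟨w, hw0, hw⟩ := hπ.exists_density_of_nonneg (h := fun x => max (h x) 0)
    (C := ‖h‖) (by
      filter_upwards [Linfty_ae_bound h, e] with x hx hx' using hx'.symm ▸ hx)
  have hew : hπ.op h = w := by
    refine Linfty_ext fun B hB hfin => ?_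
    rw [hπ.setIntegral_op h hB hfin, setIntegral_density (hm.max measurable_const)
      (fun x => le_max_right _ _) hw0 (hw B hB)]
    exact integral_congr_ae (ae_restrict_of_ae
      (ae_eq_comp_of_map_le measurable_fst hπ.fst_le e.symm))
  refine hew ▸ ⟨hw0, fun B hB => (hw B hB).trans ?_⟩
  simp only [ENNReal.ofReal_max, ENNReal.ofReal_zero, max_eq_left zero_le]

/-- The pairing of `op h` with integrable functions is integration against the subcoupling. -/
lemma integral_op_mul (hπ : IsSubcoupling π μ ν) (h : Lp ℝ ∞ μ) {k : Y → ℝ}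
    (hk : Integrable k ν) : ∫ y, hπ.op h y * k y ∂ν = ∫ z, h z.1 * k z.2 ∂π := by
  have hhm := aestronglyMeasurable_comp_of_map_le measurable_fst hπ.fst_le
    (Lp.aestronglyMeasurable h)
  have hhb := ae_comp_of_map_le measurable_fst hπ.fst_le (Linfty_ae_bound h)
  have i1 : ∀ {k : Y → ℝ}, Integrable k ν → Integrable (fun y => hπ.op h y * k y) ν := fun hk =>
    hk.bdd_mul (Lp.aestronglyMeasurable _) (Linfty_ae_bound _)
  have i2 : ∀ {k : Y → ℝ}, Integrable k ν → Integrable (fun z : X × Y => h z.1 * k z.2) π :=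
    fun hk => (integrable_comp_of_map_le measurable_snd hπ.snd_le hk).bdd_mul hhm hhb
  refine Integrable.induction (P := fun k => ∫ y, hπ.op h y * k y ∂ν = ∫ z, h z.1 * k z.2 ∂π)
    ?_ ?_ ?_ ?_ hk
  · intro c B hB hfin
    have e1 : ∀ y, hπ.op h y * B.indicator (fun _ => c) y
        = B.indicator (fun y => hπ.op h y * c) y := fun y => by
      by_cases hy : y ∈ B <;> simp [hy]
    have e2 : ∀ z : X × Y, h z.1 * B.indicator (fun _ => c) z.2
        = (Prod.snd ⁻¹' B).indicator (fun z => h z.1 * c) z := fun z => by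
      by_cases hy : z.2 ∈ B <;> simp [hy]
    simp only [e1, e2]
    rw [integral_indicator hB, integral_indicator (measurable_snd hB), integral_mul_const,
      integral_mul_const, hπ.setIntegral_op h hB hfin]
  · intro k k' _ hk hk' e e'
    simp only [Pi.add_apply, mul_add]
    rw [integral_add (i1 hk) (i1 hk'), integral_add (i2 hk) (i2 hk'), e, e']
  · exact isClosed_eq
      (continuous_integral_mul_comp measurable_id (by simp) (Lp.aestronglyMeasurable _)
        (Linfty_ae_bound _))
      (continuous_integral_mul_comp measurable_snd hπ.snd_le hhm hhb)
  · intro k k' e _ hP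
    have e' : ∫ y, hπ.op h y * k' y ∂ν = ∫ y, hπ.op h y * k y ∂ν :=
      integral_congr_ae (e.mono fun y hy => by simp only [hy])
    rw [e', hP]
    exact integral_congr_ae ((ae_eq_comp_of_map_le measurable_snd hπ.snd_le e).mono
      fun z hz => by simp only [Function.comp_apply] at hz; simp only [hz])

end IsSubcoupling

/-! ### The doubly substochastic operator of a subcoupling -/

namespace IsSubcoupling

variable {π : Measure (X × Y)} {μ : Measure X} {ν : Measure Y}

/-- The preadjoint of the operator of a subcoupling maps integrable functions to integrable
functions; this is what makes the operator weak* continuous. -/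
lemma exists_predual [SigmaFinite μ] (hπ : IsSubcoupling π μ ν) {K : X × Y → ℝ}
    (hK : Integrable K π) :
    ∃ k : Lp ℝ 1 μ, ∀ h : Lp ℝ ∞ μ, ∫ z, h z.1 * K z ∂π = ∫ x, h x * k x ∂μ := by
  have hhm := fun h : Lp ℝ ∞ μ => aestronglyMeasurable_comp_of_map_le measurable_fst hπ.fst_le
    (Lp.aestronglyMeasurable h)
  have hhb := fun h : Lp ℝ ∞ μ => ae_comp_of_map_le measurable_fst hπ.fst_le (Linfty_ae_bound h)
  have key : ∀ K : X × Y → ℝ, Integrable K π → (∀ z, 0 ≤ K z) →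
      ∃ k : Lp ℝ 1 μ, ∀ h : Lp ℝ ∞ μ, ∫ z, h z.1 * K z ∂π = ∫ x, h x * k x ∂μ := by
    intro K hK K0
    have hfin : IsFiniteMeasure (π.withDensity fun z => ENNReal.ofReal (K z)) :=
      isFiniteMeasure_withDensity_ofReal hK.2
    set ρ : Measure X := (π.withDensity fun z => ENNReal.ofReal (K z)).map Prod.fst with hρ
    have hac' : ρ ≪ π.map Prod.fst :=
      (withDensity_absolutelyContinuous _ _).map measurable_fst
    have hac : ρ ≪ μ := hac'.trans (Measure.absolutelyContinuous_of_le hπ.fst_le)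
    have hint : Integrable (fun x => (ρ.rnDeriv μ x).toReal) μ :=
      Measure.integrable_toReal_rnDeriv
    refine ⟨hint.toL1 _, fun h => ?_⟩
    have e1 : ∫ x, h x * (hint.toL1 _) x ∂μ = ∫ x, (ρ.rnDeriv μ x).toReal • h x ∂μ :=
      integral_congr_ae (hint.coeFn_toL1.mono fun x hx => by
        simp only [hx, smul_eq_mul, mul_comm])
    rw [e1, integral_rnDeriv_smul hac, hρ, integral_map measurable_fst.aemeasurable
      (((Lp.aestronglyMeasurable h).mono_ac hac)),
      integral_withDensity_eq_integral_toReal_smul₀ hK.1.aemeasurable.ennreal_ofReal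
      (Filter.Eventually.of_forall fun _ => ENNReal.ofReal_lt_top)]
    refine integral_congr_ae (Filter.Eventually.of_forall fun z => ?_)
    simp only [ENNReal.toReal_ofReal (K0 z), smul_eq_mul, mul_comm]
  obtain ⟨kp, hkp⟩ := key (fun z => max (K z) 0) hK.pos_part fun _ => le_max_right _ _
  obtain ⟨kn, hkn⟩ := key (fun z => max (-K z) 0) hK.neg_part fun _ => le_max_right _ _
  refine ⟨kp - kn, fun h => ?_⟩
  have e1 : ∫ x, h x * (kp - kn : Lp ℝ 1 μ) x ∂μ = ∫ x, (h x * kp x - h x * kn x) ∂μ :=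
    integral_congr_ae ((Lp.coeFn_sub kp kn).mono fun x hx => by
      simp only [hx, Pi.sub_apply, mul_sub])
  have e2 : ∫ z, h z.1 * K z ∂π = ∫ z, (h z.1 * max (K z) 0 - h z.1 * max (-K z) 0) ∂π :=
    integral_congr_ae (Filter.Eventually.of_forall fun z => by
      simp only [← mul_sub, max_zero_sub_max_neg_zero_eq_self])
  rw [e1, e2, integral_sub (hK.pos_part.bdd_mul (hhm h) (hhb h))
    (hK.neg_part.bdd_mul (hhm h) (hhb h)),
    integral_sub ((L1.integrable_coeFn kp).bdd_mul (Lp.aestronglyMeasurable h) (Linfty_ae_bound h))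
    ((L1.integrable_coeFn kn).bdd_mul (Lp.aestronglyMeasurable h) (Linfty_ae_bound h)), hkp, hkn]

lemma lintegral_op [SigmaFinite ν] (hπ : IsSubcoupling π μ ν) {h : Lp ℝ ∞ μ} (h0 : 0 ≤ h) :
    ∫⁻ y, ENNReal.ofReal (hπ.op h y) ∂ν = ∫⁻ x, ENNReal.ofReal (h x) ∂(π.map Prod.fst) := by
  have e := (hπ.op_nonneg_and_setLIntegral h0).2 univ MeasurableSet.univ
  rw [setLIntegral_univ, preimage_univ, setLIntegral_univ] at e
  rw [e, lintegral_map (Lp.stronglyMeasurable h).measurable.ennreal_ofReal measurable_fst]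

lemma setLIntegral_op_one [SigmaFinite ν] (hπ : IsSubcoupling π μ ν) {B : Set Y}
    (hB : MeasurableSet B) :
    ∫⁻ y in B, ENNReal.ofReal (hπ.op (one μ) y) ∂ν = π.map Prod.snd B := by
  have h0 : 0 ≤ one μ := (Lp.coeFn_nonneg _).1 ((one_ae_eq μ).mono fun x hx => by
    rw [hx]; exact zero_le_one)
  rw [(hπ.op_nonneg_and_setLIntegral h0).2 B hB, Measure.map_apply measurable_snd hB,
    ← setLIntegral_one]
  refine lintegral_congr_ae (ae_restrict_of_ae ?_)
  filter_upwards [ae_comp_of_map_le measurable_fst hπ.fst_le (one_ae_eq μ)] with z hz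
  rw [hz, ENNReal.ofReal_one]

lemma integrable_fst_mul_snd (hπ : IsSubcoupling π μ ν) (k : Lp ℝ 1 μ) (h : Lp ℝ ∞ ν) :
    Integrable (fun z : X × Y => h z.2 * k z.1) π :=
  (integrable_comp_of_map_le measurable_fst hπ.fst_le (L1.integrable_coeFn k)).bdd_mul
    (aestronglyMeasurable_comp_of_map_le measurable_snd hπ.snd_le (Lp.aestronglyMeasurable h))
    (ae_comp_of_map_le measurable_snd hπ.snd_le (Linfty_ae_bound h))

variable [SigmaFinite μ] [SigmaFinite ν]

/-- The doubly substochastic operator of a subcoupling. -/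
def dss (hπ : IsSubcoupling π μ ν) : DSS μ ν where
  op := hπ.op
  positive h h0 := (hπ.op_nonneg_and_setLIntegral h0).1
  weakStar_continuous := by
    refine continuous_induced_rng.2 (@continuous_pi _ _ _ (weakStar μ) _ _ fun k => ?_)
    obtain ⟨k', hk'⟩ := hπ.exists_predual
      (integrable_comp_of_map_le measurable_snd hπ.snd_le (L1.integrable_coeFn k))
    have e : (fun h : Lp ℝ ∞ μ => ∫ y, hπ.op h y * k y ∂ν) = fun h => ∫ x, h x * k' x ∂μ :=
      funext fun h => (hπ.integral_op_mul h (L1.integrable_coeFn k)).trans (hk' h)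
    change @Continuous _ _ (weakStar μ) _ (fun h : Lp ℝ ∞ μ => ∫ y, hπ.op h y * k y ∂ν)
    rw [e]
    have hd : @Continuous _ _ (weakStar μ) _
        fun (h : Lp ℝ ∞ μ) (k : Lp ℝ 1 μ) => ∫ x, h x * k x ∂μ := continuous_induced_dom
    exact (@continuous_pi_iff _ _ _ (weakStar μ) _ _).1 hd k'
  subunital := by
    have h1 : (fun y => ENNReal.ofReal (hπ.op (one μ) y)) ≤ᵐ[ν] fun _ => 1 := by
      refine ae_le_of_forall_setLIntegral_le_of_sigmaFinite
        (Lp.stronglyMeasurable _).measurable.ennreal_ofReal fun B hB _ => ?_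
      rw [hπ.setLIntegral_op_one hB, setLIntegral_one]
      exact hπ.snd_le B
    refine (Lp.coeFn_le _ _).1 ?_
    filter_upwards [h1, one_ae_eq ν] with y hy hy'
    rw [hy']
    exact ENNReal.ofReal_le_one.1 hy
  integral_le h h0 _ := (hπ.lintegral_op h0).trans_le (lintegral_mono' hπ.fst_le le_rfl)

/-- A coupling with full marginals gives a doubly stochastic operator. -/
lemma isDS_dss (hπ : IsSubcoupling π μ ν) (h1 : π.map Prod.fst = μ) (h2 : π.map Prod.snd = ν) :
    hπ.dss.IsDS := by
  refine ⟨?_, fun h h0 _ => (hπ.lintegral_op h0).trans (by rw [h1])⟩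
  have h3 : (fun y => ENNReal.ofReal (hπ.op (one μ) y)) =ᵐ[ν] fun _ => 1 := by
    refine ae_eq_of_forall_setLIntegral_eq_of_sigmaFinite
      (Lp.stronglyMeasurable _).measurable.ennreal_ofReal measurable_const fun B hB _ => ?_
    rw [hπ.setLIntegral_op_one hB, setLIntegral_one, h2]
  refine Lp.ext ?_
  filter_upwards [h3, one_ae_eq ν] with y hy hy'
  rw [hy']
  exact ENNReal.ofReal_eq_one.1 hy

/-- The extension to `L¹`, paired with bounded functions, is again integration against the
subcoupling. -/
lemma integral_mul_onL1 (hπ : IsSubcoupling π μ ν) (k : Lp ℝ 1 μ) (h : Lp ℝ ∞ ν) :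
    ∫ y, h y * hπ.dss.onL1 k y ∂ν = ∫ z, h z.2 * k z.1 ∂π := by
  refine (LOneInf.denseRange_toL1 μ).induction_on
    (p := fun k => ∫ y, h y * hπ.dss.onL1 k y ∂ν = ∫ z, h z.2 * k z.1 ∂π) k ?_ ?_
  · exact isClosed_eq
      ((continuous_integral_mul_comp measurable_id (by simp) (Lp.aestronglyMeasurable h)
        (Linfty_ae_bound h)).comp hπ.dss.onL1.continuous)
      (continuous_integral_mul_comp measurable_fst hπ.fst_le
        (aestronglyMeasurable_comp_of_map_le measurable_snd hπ.snd_le (Lp.aestronglyMeasurable h))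
        (ae_comp_of_map_le measurable_snd hπ.snd_le (Linfty_ae_bound h)))
  · intro k'
    have hk : (k' : Lp ℝ ∞ μ) =ᵐ[μ] LOneInf.toL1 μ k' :=
      (Integrable.coeFn_toL1 (LOneInf.integrable k')).symm
    have hT := hπ.dss.onL1_ae_eq k' (LOneInf.toL1 μ k') hk
    have hTi : Integrable (hπ.op k') ν := hπ.dss.integrable_op k'
    have e1 : ∫ y, h y * hπ.dss.onL1 (LOneInf.toL1 μ k') y ∂ν = ∫ y, h y * hπ.op k' y ∂ν :=
      integral_congr_ae (hT.mono fun y hy => by simp only [hy]; rfl)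
    have hkπ := ae_eq_comp_of_map_le measurable_fst hπ.fst_le hk
    have hi1 : Integrable (fun y => h y * hπ.op k' y) ν :=
      hTi.bdd_mul (Lp.aestronglyMeasurable h) (Linfty_ae_bound h)
    have hi2 := hπ.integrable_fst_mul_snd (LOneInf.toL1 μ k') h
    rw [e1]
    -- Cut `h` off to sets of finite measure: `integral_op_mul` needs an integrable factor.
    set S := spanningSets ν
    have hev : ∀ y, ∀ᶠ n in Filter.atTop, y ∈ S n := fun y => by
      obtain ⟨n, hn⟩ := mem_iUnion.1 ((iUnion_spanningSets ν).symm ▸ mem_univ y)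
      filter_upwards [Filter.eventually_ge_atTop n] with m hm
      exact monotone_spanningSets ν hm hn
    have t1 : Filter.Tendsto (fun n => ∫ y, (S n).indicator (fun y => h y * hπ.op k' y) y ∂ν)
        Filter.atTop (nhds (∫ y, h y * hπ.op k' y ∂ν)) := by
      refine tendsto_integral_of_dominated_convergence (fun y => ‖h y * hπ.op k' y‖)
        (fun n => hi1.1.indicator (measurableSet_spanningSets ν n)) hi1.norm
        (fun n => Filter.Eventually.of_forall fun y => norm_indicator_le_norm_self _ _)
        (Filter.Eventually.of_forall fun y => tendsto_const_nhds.congr' ?_)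
      filter_upwards [hev y] with n hn
      rw [indicator_of_mem hn]
    have t2 : Filter.Tendsto (fun n => ∫ z, (Prod.snd ⁻¹' S n).indicator
        (fun z : X × Y => h z.2 * LOneInf.toL1 μ k' z.1) z ∂π)
        Filter.atTop (nhds (∫ z, h z.2 * LOneInf.toL1 μ k' z.1 ∂π)) := by
      refine tendsto_integral_of_dominated_convergence
        (fun z => ‖h z.2 * LOneInf.toL1 μ k' z.1‖)
        (fun n => hi2.1.indicator (measurable_snd (measurableSet_spanningSets ν n))) hi2.norm
        (fun n => Filter.Eventually.of_forall fun y => norm_indicator_le_norm_self _ _)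
        (Filter.Eventually.of_forall fun z => tendsto_const_nhds.congr' ?_)
      filter_upwards [hev z.2] with n hn
      rw [indicator_of_mem (show z ∈ Prod.snd ⁻¹' S n from hn)]
    refine tendsto_nhds_unique t1 (t2.congr fun n => ?_)
    have hn : Integrable ((S n).indicator h) ν := (integrable_indicator_iff
      (measurableSet_spanningSets ν n)).2 (integrableOn_Linfty h (measure_spanningSets_lt_top ν n))
    have e2 := hπ.integral_op_mul (k' : Lp ℝ ∞ μ) hn
    calc ∫ z, (Prod.snd ⁻¹' S n).indicator
          (fun z : X × Y => h z.2 * LOneInf.toL1 μ k' z.1) z ∂π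
        = ∫ z, (k' : Lp ℝ ∞ μ) z.1 * (S n).indicator h z.2 ∂π := by
          refine integral_congr_ae (hkπ.mono fun z hz => ?_)
          simp only [Function.comp_apply] at hz
          by_cases hm : z.2 ∈ S n <;> simp [hm, hz, mul_comm]
      _ = ∫ y, hπ.op k' y * (S n).indicator h y ∂ν := e2.symm
      _ = _ := by
          refine integral_congr_ae (Filter.Eventually.of_forall fun y => ?_)
          by_cases hm : y ∈ S n <;> simp [hm, mul_comm]

/-- Exchanging the two coordinates of the subcoupling gives the dual operator. -/
lemma isDual_dss (hπ : IsSubcoupling π μ ν) : hπ.dss.IsDual hπ.swap.dss := by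
  intro k h
  rw [hπ.integral_mul_onL1]
  refine Eq.trans ?_ (hπ.swap.integral_op_mul h (L1.integrable_coeFn k)).symm
  exact (integral_map_equiv (MeasurableEquiv.prodComm) (fun z : Y × X => h z.1 * k z.2)).symm

/-- The extension to `L¹` is described by the same densities as the operator on `L^∞`. -/
lemma setIntegral_onL1 (hπ : IsSubcoupling π μ ν) (k : Lp ℝ 1 μ) {B : Set Y}
    (hB : MeasurableSet B) :
    ∫ y in B, hπ.dss.onL1 k y ∂ν = ∫ z in Prod.snd ⁻¹' B, k z.1 ∂π := by
  have e := hπ.integral_mul_onL1 k (chi ν hB)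
  rw [← integral_indicator hB, ← integral_indicator (measurable_snd hB)]
  refine Eq.trans (integral_congr_ae ?_) (e.trans (integral_congr_ae ?_))
  · filter_upwards [chi_ae_eq ν hB] with y hy
    by_cases hm : y ∈ B <;> simp [hy, hm]
  · filter_upwards [ae_comp_of_map_le measurable_snd hπ.snd_le (chi_ae_eq ν hB)] with z hy
    by_cases hm : z.2 ∈ B <;> simp [hy, hm]

lemma onL1_eq_of_setIntegral (hπ : IsSubcoupling π μ ν) {k : Lp ℝ 1 μ} {g : Lp ℝ 1 ν}
    (h : ∀ B, MeasurableSet B → ∫ z in Prod.snd ⁻¹' B, k z.1 ∂π = ∫ y in B, g y ∂ν) :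
    hπ.dss.onL1 k = g :=
  Lp.ext (Integrable.ae_eq_of_forall_setIntegral_eq _ _ (L1.integrable_coeFn _)
    (L1.integrable_coeFn _) fun B hB _ => (hπ.setIntegral_onL1 k hB).trans (h B hB))

/-- If a subcoupling is carried by the set where `f x = g y` and its second marginal is all
of `ν` on the support of `g`, then its operator maps `f` to `g`. -/
lemma onL1_eq_of_ae_eq (hπ : IsSubcoupling π μ ν) {f : Lp ℝ 1 μ} {g : Lp ℝ 1 ν}
    (hfg : ∀ᵐ z ∂π, f z.1 = g z.2) {A : Set Y} (hsnd : π.map Prod.snd = ν.restrict A)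
    (hA : ∀ᵐ y ∂ν, y ∉ A → g y = 0) : hπ.dss.onL1 f = g := by
  refine hπ.onL1_eq_of_setIntegral fun B hB => ?_
  have e1 : ∫ z in Prod.snd ⁻¹' B, f z.1 ∂π = ∫ z in Prod.snd ⁻¹' B, g z.2 ∂π :=
    integral_congr_ae (ae_restrict_of_ae hfg)
  have e2 : ∫ z in Prod.snd ⁻¹' B, g z.2 ∂π = ∫ y in B, g y ∂(π.map Prod.snd) :=
    (setIntegral_map hB ((Lp.aestronglyMeasurable g).mono_measure hπ.snd_le)
      measurable_snd.aemeasurable).symm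
  rw [e1, e2, hsnd, Measure.restrict_restrict hB]
  refine (setIntegral_eq_of_subset_of_ae_sdiff_eq_zero hB.nullMeasurableSet
    inter_subset_left ?_).symm
  filter_upwards [hA] with y hy hm
  exact hy fun hyA => hm.2 ⟨hm.1, hyA⟩

end IsSubcoupling

/-! ### Composition and order properties of doubly substochastic operators -/

namespace DSS

variable {Z : Type*} [MeasurableSpace Z] {μ : Measure X} {ν : Measure Y} {ρ : Measure Z}

lemma op_mono (T : DSS μ ν) {h k : Lp ℝ ∞ μ} (hk : h ≤ k) : T.op h ≤ T.op k := by
  rw [← sub_nonneg, ← map_sub]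
  exact T.positive _ (sub_nonneg.2 hk)

/-- The composition of two doubly substochastic operators. -/
def comp (S : DSS ν ρ) (T : DSS μ ν) : DSS μ ρ where
  op := S.op ∘ₗ T.op
  positive h h0 := S.positive _ (T.positive h h0)
  weakStar_continuous := @Continuous.comp _ _ _ (weakStar μ) (weakStar ν) (weakStar ρ) _ _
    S.weakStar_continuous T.weakStar_continuous
  subunital := (S.op_mono T.subunital).trans S.subunital
  integral_le h h0 hi :=
    (S.integral_le _ (T.positive h h0) (T.integrable_op ⟨h, hi⟩)).trans (T.integral_le h h0 hi)

lemma onL1_comp (S : DSS ν ρ) (T : DSS μ ν) (k : Lp ℝ 1 μ) :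
    (S.comp T).onL1 k = S.onL1 (T.onL1 k) := by
  rw [← (S.comp T).onL1_unique (S.onL1.comp T.onL1)]
  · rfl
  · exact fun h k hk => S.onL1_ae_eq _ _ (T.onL1_ae_eq h k hk).symm

lemma IsDual.comp {S : DSS ν ρ} {T : DSS μ ν} {S' : DSS ρ ν} {T' : DSS ν μ}
    (hS : S.IsDual S') (hT : T.IsDual T') : (S.comp T).IsDual (T'.comp S') := by
  intro k h
  rw [onL1_comp, hS, hT]
  rfl

lemma onL1_nonneg (T : DSS μ ν) {k : Lp ℝ 1 μ} (hk : 0 ≤ k) : 0 ≤ T.onL1 k := by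
  refine (Lp.simpleFunc.denseRange_coeSimpleFuncNonnegToLpNonneg 1 μ ℝ
    ENNReal.one_ne_top).induction_on (p := fun k => 0 ≤ T.onL1 (k : Lp ℝ 1 μ)) ⟨k, hk⟩ ?_ ?_
  · exact isClosed_le continuous_const (T.onL1.continuous.comp continuous_subtype_val)
  · rintro ⟨s, hs⟩
    have hs' : Lp.simpleFunc.toSimpleFunc s =ᵐ[μ] (s : Lp ℝ 1 μ) :=
      Lp.simpleFunc.toSimpleFunc_eq_toFun s
    have hinf : MemLp (Lp.simpleFunc.toSimpleFunc s) ∞ μ := SimpleFunc.memLp_top _ μ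
    have h0 : 0 ≤ hinf.toLp _ := by
      refine (Lp.coeFn_nonneg _).1 ?_
      filter_upwards [hinf.coeFn_toLp, hs', (Lp.coeFn_nonneg (s : Lp ℝ 1 μ)).2 hs] with x h1 h2 h3
      rw [h1, h2]; exact h3
    have e := T.onL1_ae_eq (hinf.toLp _) s (hinf.coeFn_toLp.trans hs')
    refine (Lp.coeFn_nonneg _).1 ?_
    filter_upwards [e, (Lp.coeFn_nonneg _).2 (T.positive _ h0)] with y h1 h2
    exact h2.trans_eq h1.symm

lemma onL1_mono (T : DSS μ ν) {k k' : Lp ℝ 1 μ} (hk : k ≤ k') : T.onL1 k ≤ T.onL1 k' := by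
  rw [← sub_nonneg, ← map_sub]
  exact T.onL1_nonneg (sub_nonneg.2 hk)

lemma norm_onL1_le (T : DSS μ ν) (k : Lp ℝ 1 μ) : ‖T.onL1 k‖ ≤ ‖k‖ := by
  have h := LinearMap.norm_extendOfNorm_apply_le (f := T.opL1) (LOneInf.denseRange_toL1 μ) 1
    T.norm_opL1_le k
  rwa [one_mul] at h

lemma integral_onL1_le (T : DSS μ ν) {k : Lp ℝ 1 μ} (hk : 0 ≤ k) :
    ∫ y, T.onL1 k y ∂ν ≤ ∫ x, k x ∂μ := by
  have h := T.norm_onL1_le k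
  rw [L1.norm_eq_integral_norm, L1.norm_eq_integral_norm] at h
  refine ((integral_congr_ae ?_).trans_le h).trans_eq (integral_congr_ae ?_)
  · filter_upwards [(Lp.coeFn_nonneg _).2 (T.onL1_nonneg hk)] with y hy
    exact (Real.norm_of_nonneg hy).symm
  · filter_upwards [(Lp.coeFn_nonneg _).2 hk] with y hy
    exact Real.norm_of_nonneg hy

/-- An integrable function bounded above by the constant `c ≥ 0` has image at most `c`. -/
lemma onL1_ae_le_const (T : DSS μ ν) {k : Lp ℝ 1 μ} {c : ℝ} (hc : 0 ≤ c)
    (hk : ∀ᵐ x ∂μ, k x ≤ c) : ∀ᵐ y ∂ν, T.onL1 k y ≤ c := by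
  -- Replace `k` by its positive part, which is bounded.
  have hb : MemLp (fun x => max (k x) 0) ∞ μ := by
    refine memLp_top_of_bound ((Lp.aestronglyMeasurable k).sup aestronglyMeasurable_const) c ?_
    filter_upwards [hk] with x hx
    rw [Real.norm_of_nonneg (le_max_right _ _)]
    exact max_le hx hc
  have e := T.onL1_ae_eq (hb.toLp _) (Lp.posPart k) (hb.coeFn_toLp.trans (Lp.coeFn_posPart k).symm)
  have h1 : T.onL1 k ≤ T.onL1 (Lp.posPart k) := T.onL1_mono ((Lp.coeFn_le _ _).1
    ((Lp.coeFn_posPart k).mono fun x hx => by rw [hx]; exact le_max_left _ _))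
  have h2 : hb.toLp _ ≤ c • one μ := by
    refine (Lp.coeFn_le _ _).1 ?_
    filter_upwards [hb.coeFn_toLp, Lp.coeFn_smul c (one μ), one_ae_eq μ, hk] with x a1 a2 a3 a4
    rw [a1, a2, Pi.smul_apply, a3, smul_eq_mul, mul_one]
    exact max_le a4 hc
  have h3 := T.op_mono h2
  rw [map_smul] at h3
  filter_upwards [e, (Lp.coeFn_le _ _).2 h1, (Lp.coeFn_le _ _).2 h3,
    Lp.coeFn_smul c (T.op (one μ)), (Lp.coeFn_le _ _).2 T.subunital, one_ae_eq ν]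
    with y a1 a2 a3 a4 a5 a6
  rw [a4, Pi.smul_apply, smul_eq_mul] at a3
  rw [a6] at a5
  rw [a1] at a2
  exact a2.trans (a3.trans ((mul_le_mul_of_nonneg_left a5 hc).trans_eq (mul_one c)))

end DSS

/-! ### Jensen's inequality for doubly substochastic operators -/

lemma monotoneOn_of_convexOn {φ : ℝ → ℝ} (hφ : ConvexOn ℝ (Ici 0) φ)
    (hpos : ∀ x, 0 ≤ x → 0 ≤ φ x) (h0 : φ 0 = 0) : MonotoneOn φ (Ici 0) := by
  intro x hx y hy hxy
  rcases eq_or_lt_of_le (show (0 : ℝ) ≤ y from hy) with rfl | hy0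
  · rw [le_antisymm hxy hx]
  have hx0 : 0 ≤ x := hx
  have h := hφ.2 (mem_Ici.2 (le_refl (0 : ℝ))) hy
    (show 0 ≤ 1 - x / y from sub_nonneg.2 ((div_le_one hy0).2 hxy))
    (show 0 ≤ x / y by positivity) (by ring)
  simp only [smul_eq_mul, mul_zero, h0, zero_add] at h
  rw [div_mul_cancel₀ _ hy0.ne'] at h
  exact h.trans (mul_le_of_le_one_left (hpos y hy) ((div_le_one hy0).2 hxy))

/-- Jensen's inequality in integrated form. The function `φ` is a countable supremum of affine
functions `s ↦ a s - b` with `b ≥ 0`, and `a f - φ ∘ f ≤ b` gives `a T f - T (φ ∘ f) ≤ b` since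
`T` is substochastic. -/
lemma DSS.lintegral_convex_le {μ : Measure X} {ν : Measure Y} (T : DSS μ ν) {f : Lp ℝ 1 μ}
    (hf : 0 ≤ f) {φ : ℝ → ℝ} (hφ : ConvexOn ℝ (Ici 0) φ)
    (hpos : ∀ x, 0 ≤ x → 0 ≤ φ x) (h0 : φ 0 = 0) :
    ∫⁻ y, ENNReal.ofReal (φ (T.onL1 f y)) ∂ν ≤ ∫⁻ x, ENNReal.ofReal (φ (f x)) ∂μ := by
  have hmono := monotoneOn_of_convexOn hφ hpos h0
  set ψ : ℝ → ℝ := fun x => φ (max x 0) with hψ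
  have hψ0 : ∀ x, 0 ≤ x → ψ x = φ x := fun x hx => by simp only [hψ, max_eq_left hx]
  have hψmono : Monotone ψ := fun x y hxy =>
    hmono (mem_Ici.2 (le_max_right _ _)) (mem_Ici.2 (le_max_right _ _)) (max_le_max hxy le_rfl)
  have himg : (fun x : ℝ => max x 0) '' univ = Ici 0 := by
    ext x
    simp only [image_univ, mem_range, mem_Ici]
    exact ⟨fun ⟨y, hy⟩ => hy ▸ le_max_right _ _, fun hx => ⟨x, max_eq_left hx⟩⟩
  have hψc : ConvexOn ℝ univ ψ := by
    have hmax : ConvexOn ℝ univ fun x : ℝ => max x 0 :=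
      (convexOn_id convex_univ).sup (convexOn_const 0 convex_univ)
    exact ConvexOn.comp (g := φ) (himg ▸ hφ) hmax (himg ▸ hmono)
  have hψcont : Continuous ψ := continuousOn_univ.1 (hψc.continuousOn isOpen_univ)
  obtain ⟨l, c, hle, hsup⟩ := hψc.real_univ_sSup_of_nat_affine_eq hψcont.lowerSemicontinuous
  have hl : ∀ i x, l i x = l i 1 * x := fun i x => by
    rw [mul_comm, ← smul_eq_mul, ← map_smul, smul_eq_mul, mul_one]
  have hle' : ∀ i x, l i 1 * x + c i ≤ ψ x := fun i x => by
    rw [← hl]; exact hle i x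
  have hc : ∀ i, 0 ≤ -c i := fun i => by
    have := hle' i 0
    rw [hψ0 0 le_rfl, h0, mul_zero, zero_add] at this
    linarith
  have hfx := (Lp.coeFn_nonneg f).2 hf
  have hgx := (Lp.coeFn_nonneg _).2 (T.onL1_nonneg hf)
  have e1 : ∫⁻ x, ENNReal.ofReal (φ (f x)) ∂μ = ∫⁻ x, ENNReal.ofReal (ψ (f x)) ∂μ :=
    lintegral_congr_ae (hfx.mono fun x hx => by simp only [hψ0 _ hx])
  have e2 : ∫⁻ y, ENNReal.ofReal (φ (T.onL1 f y)) ∂ν = ∫⁻ y, ENNReal.ofReal (ψ (T.onL1 f y)) ∂ν :=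
    lintegral_congr_ae (hgx.mono fun x hx => by simp only [hψ0 _ hx])
  rw [e1, e2]
  by_cases htop : ∫⁻ x, ENNReal.ofReal (ψ (f x)) ∂μ = ∞
  · rw [htop]; exact le_top
  have hψn : ∀ x, 0 ≤ ψ x := fun x => hpos _ (le_max_right _ _)
  have hint : Integrable (fun x => ψ (f x)) μ :=
    ⟨(hψmono.measurable.comp (Lp.stronglyMeasurable f).measurable).aestronglyMeasurable,
      (hasFiniteIntegral_iff_ofReal (Filter.Eventually.of_forall fun x => hψn _)).2
        (lt_top_iff_ne_top.2 htop)⟩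
  set k : Lp ℝ 1 μ := hint.toL1 _
  have hk : k =ᵐ[μ] fun x => ψ (f x) := hint.coeFn_toL1
  have hk0 : 0 ≤ k := (Lp.coeFn_nonneg _).1 (hk.mono fun x hx => by rw [hx]; exact hψn _)
  have hT : ∀ i, ∀ᵐ y ∂ν, l i 1 * T.onL1 f y + c i ≤ T.onL1 k y := by
    intro i
    have hb := T.onL1_ae_le_const (k := l i 1 • f - k) (hc i) (by
      filter_upwards [Lp.coeFn_sub (l i 1 • f) k, Lp.coeFn_smul (l i 1) f, hk] with x a1 a2 a3
      rw [a1, Pi.sub_apply, a2, a3, Pi.smul_apply, smul_eq_mul]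
      linarith [hle' i (f x)])
    rw [map_sub, map_smul] at hb
    filter_upwards [hb, Lp.coeFn_sub (l i 1 • T.onL1 f) (T.onL1 k),
      Lp.coeFn_smul (l i 1) (T.onL1 f)] with y a1 a2 a3
    rw [a2, Pi.sub_apply, a3, Pi.smul_apply, smul_eq_mul] at a1
    linarith
  have hJ : ∀ᵐ y ∂ν, ψ (T.onL1 f y) ≤ T.onL1 k y := by
    filter_upwards [ae_all_iff.2 hT] with y hy
    rw [← hsup, iSup_apply]
    · refine ciSup_le fun i => ?_
      refine le_trans (le_of_eq ?_) (hy i)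
      simp [← hl]
  calc ∫⁻ y, ENNReal.ofReal (ψ (T.onL1 f y)) ∂ν
      ≤ ∫⁻ y, ENNReal.ofReal (T.onL1 k y) ∂ν :=
        lintegral_mono_ae (hJ.mono fun y hy => ENNReal.ofReal_le_ofReal hy)
    _ = ENNReal.ofReal (∫ y, T.onL1 k y ∂ν) :=
        (ofReal_integral_eq_lintegral_ofReal (L1.integrable_coeFn _)
          ((Lp.coeFn_nonneg _).2 (T.onL1_nonneg hk0))).symm
    _ ≤ ENNReal.ofReal (∫ x, k x ∂μ) := ENNReal.ofReal_le_ofReal (T.integral_onL1_le hk0)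
    _ = ENNReal.ofReal (∫ x, ψ (f x) ∂μ) := by rw [integral_congr_ae hk]
    _ = ∫⁻ x, ENNReal.ofReal (ψ (f x)) ∂μ :=
        ofReal_integral_eq_lintegral_ofReal hint (Filter.Eventually.of_forall fun x => hψn _)

lemma integrable_max_sub {μ : Measure X} {f : X → ℝ} (hf : Integrable f μ)
    {t : ℝ} (ht : 0 ≤ t) : Integrable (fun x => max (f x - t) 0) μ := by
  refine hf.mono ((hf.1.sub aestronglyMeasurable_const).sup aestronglyMeasurable_const)
    (Filter.Eventually.of_forall fun x => ?_)
  rw [Real.norm_of_nonneg (le_max_right _ _)]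
  exact max_le ((sub_le_self _ ht).trans (le_abs_self _)) (abs_nonneg _)

/-- Convex test functions control the excess integrals `∫ (f - t)₊`. -/
lemma integral_max_sub_le_of_convex {μ : Measure X} {ν : Measure Y} {f : Lp ℝ 1 μ} {g : Lp ℝ 1 ν}
    (h : ∀ φ : ℝ → ℝ, ConvexOn ℝ (Ici 0) φ → (∀ x, 0 ≤ x → 0 ≤ φ x) → φ 0 = 0 →
      ∫⁻ y, ENNReal.ofReal (φ (g y)) ∂ν ≤ ∫⁻ x, ENNReal.ofReal (φ (f x)) ∂μ)
    {t : ℝ} (ht : 0 ≤ t) : ∫ y, max (g y - t) 0 ∂ν ≤ ∫ x, max (f x - t) 0 ∂μ := by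
  have hc : ConvexOn ℝ (Ici 0) fun s : ℝ => max (s - t) 0 :=
    (((convexOn_id (convex_Ici 0)).sub (concaveOn_const t (convex_Ici 0)))).sup
      (convexOn_const 0 (convex_Ici 0))
  have h1 := h _ hc (fun x _ => le_max_right _ _) (by simp [ht])
  rw [← ofReal_integral_eq_lintegral_ofReal (integrable_max_sub (L1.integrable_coeFn g) ht)
      (Filter.Eventually.of_forall fun x => le_max_right _ _),
    ← ofReal_integral_eq_lintegral_ofReal (integrable_max_sub (L1.integrable_coeFn f) ht)
      (Filter.Eventually.of_forall fun x => le_max_right _ _)] at h1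
  exact (ENNReal.ofReal_le_ofReal_iff (integral_nonneg fun x => le_max_right _ _)).1 h1

/-! ### Equimeasurability of the decreasing rearrangement -/

lemma rearrangement_le_of_distribution_le {μ : Measure X} {f : X → ℝ} {r t : ℝ} (ht : 0 ≤ t)
    (h : distribution μ f t ≤ ENNReal.ofReal r) : rearrangement μ f r ≤ t :=
  csInf_le ⟨0, fun _ hs => hs.1⟩ ⟨ht, h⟩

/-- The distribution function is continuous from the right. -/
lemma distribution_le_of_forall_gt {μ : Measure X} {f : X → ℝ} {t : ℝ} {c : ℝ≥0∞}
    (h : ∀ s, t < s → distribution μ f s ≤ c) : distribution μ f t ≤ c := by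
  have hU : {x | t < f x} = ⋃ n : ℕ, {x | t + 1 / ((n : ℝ) + 1) < f x} := by
    ext x
    simp only [mem_ofPred_eq, mem_iUnion]
    refine ⟨fun hx => ?_, fun ⟨n, hn⟩ =>
      lt_trans (by linarith [Nat.one_div_pos_of_nat (α := ℝ) (n := n)]) hn⟩
    obtain ⟨n, hn⟩ := exists_nat_one_div_lt (sub_pos.2 hx)
    exact ⟨n, by linarith⟩
  have hm : Monotone fun n : ℕ => {x | t + 1 / ((n : ℝ) + 1) < f x} := by
    intro m n hmn x hx
    have := Nat.one_div_le_one_div (α := ℝ) hmn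
    simp only [mem_ofPred_eq] at hx ⊢
    linarith
  rw [distribution, hU, hm.measure_iUnion]
  exact iSup_le fun n => h _ (by linarith [Nat.one_div_pos_of_nat (α := ℝ) (n := n)])

/-- The rearrangement is a generalized inverse of the distribution function. -/
lemma lt_rearrangement_iff {μ : Measure X} {f : X → ℝ} (hf : Integrable f μ) {r t : ℝ}
    (hr : 0 < r) (ht : 0 ≤ t) :
    t < rearrangement μ f r ↔ ENNReal.ofReal r < distribution μ f t := by
  refine ⟨fun h => not_le.1 fun hle => h.not_ge (rearrangement_le_of_distribution_le ht hle),
    fun h => not_le.1 fun hle => h.not_ge (distribution_le_of_forall_gt fun s hs => ?_)⟩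
  obtain ⟨u, hu, hus⟩ := exists_lt_of_csInf_lt (rearrangement_set_nonempty hf hr)
    (lt_of_le_of_lt hle hs)
  exact (measure_mono fun x (hx : s < f x) => hus.trans hx).trans hu.2

lemma halfLine_lt_rearrangement {μ : Measure X} {f : X → ℝ} (hf : Integrable f μ) {t : ℝ}
    (ht : 0 ≤ t) : halfLine {r | t < rearrangement μ f r} = distribution μ f t := by
  rw [halfLine_eq, Measure.restrict_apply' measurableSet_Ioi]
  have e : {r | t < rearrangement μ f r} ∩ Ioi 0
      = {r | ENNReal.ofReal r < distribution μ f t} ∩ Ioi 0 := by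
    ext r
    exact and_congr_left fun hr => lt_rearrangement_iff hf hr ht
  rw [e]
  by_cases htop : distribution μ f t = ∞
  · have e2 : {r | ENNReal.ofReal r < distribution μ f t} ∩ Ioi 0 = Ioi 0 := by
      rw [htop]; ext r; simp
    rw [e2, Real.volume_Ioi, htop]
  · have e2 : {r | ENNReal.ofReal r < distribution μ f t} ∩ Ioi 0
        = Ioo 0 (distribution μ f t).toReal := by
      ext r
      simp only [mem_inter_iff, mem_ofPred_eq, mem_Ioi, mem_Ioo]
      exact ⟨fun h => ⟨h.2, (ENNReal.ofReal_lt_iff_lt_toReal h.2.le htop).1 h.1⟩,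
        fun h => ⟨(ENNReal.ofReal_lt_iff_lt_toReal h.1.le htop).2 h.2, h.1⟩⟩
    rw [e2, Real.volume_Ioo, sub_zero, ENNReal.ofReal_toReal htop]

lemma integral_rearrangement_max_sub {μ : Measure X} {f : X → ℝ} (hf : Integrable f μ) {t : ℝ}
    (ht : 0 ≤ t) :
    ∫ r, max (rearrangement μ f r - t) 0 ∂halfLine = ∫ x, max (f x - t) 0 ∂μ := by
  have hF := integrable_rearrangement hf
  have n1 : ∀ᵐ r ∂halfLine, 0 ≤ max (rearrangement μ f r - t) 0 :=
    Filter.Eventually.of_forall fun r => le_max_right _ _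
  have n2 : ∀ᵐ x ∂μ, 0 ≤ max (f x - t) 0 := Filter.Eventually.of_forall fun r => le_max_right _ _
  rw [integral_eq_lintegral_of_nonneg_ae n1 (integrable_max_sub hF ht).1,
    integral_eq_lintegral_of_nonneg_ae n2 (integrable_max_sub hf ht).1,
    lintegral_eq_lintegral_meas_lt _ n1 (integrable_max_sub hF ht).1.aemeasurable,
    lintegral_eq_lintegral_meas_lt _ n2 (integrable_max_sub hf ht).1.aemeasurable]
  congr 1
  refine setLIntegral_congr_fun measurableSet_Ioi fun s (hs : 0 < s) => ?_
  have e : ∀ a : ℝ, s < max (a - t) 0 ↔ s + t < a := fun a => by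
    rw [lt_max_iff, lt_sub_iff_add_lt]
    exact or_iff_left hs.le.not_gt
  simp only [e]
  exact halfLine_lt_rearrangement hf (by linarith)

lemma integral_rearrangement {μ : Measure X} {f : X → ℝ} (hf : Integrable f μ) (h0 : 0 ≤ᵐ[μ] f) :
    ∫ r, rearrangement μ f r ∂halfLine = ∫ x, f x ∂μ := by
  have h := integral_rearrangement_max_sub hf le_rfl
  simp only [sub_zero] at h
  have e : ∫ x, max (f x) 0 ∂μ = ∫ x, f x ∂μ :=
    integral_congr_ae (h0.mono fun x hx => max_eq_left hx)
  rw [← e, ← h]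
  exact integral_congr_ae (Filter.Eventually.of_forall fun r =>
    (max_eq_left (rearrangement_nonneg μ f r)).symm)

lemma lorenz_eq_setIntegral (μ : Measure X) (f : X → ℝ) {r : ℝ} (hr : 0 ≤ r) :
    lorenz μ f r = ∫ s in Ioc 0 r, rearrangement μ f s := intervalIntegral.integral_of_le hr

/-- The excess integrals `∫ (f - t)₊` control the Lorenz curve, because
`L_f(r) = inf_{t ≥ 0} (r t + ∫ (f - t)₊)`, attained at `t = f↓(r)`. -/
lemma submajorizes_of_integral_max_sub_le {μ : Measure X} {ν : Measure Y} {f : Lp ℝ 1 μ}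
    {g : Lp ℝ 1 ν}
    (h : ∀ t : ℝ, 0 ≤ t → ∫ y, max (g y - t) 0 ∂ν ≤ ∫ x, max (f x - t) 0 ∂μ) :
    Submajorizes f g := by
  intro r hr
  have hf := L1.integrable_coeFn f
  have hg := L1.integrable_coeFn g
  set F := rearrangement μ f
  set G := rearrangement ν g
  set s := F r
  have hs0 : 0 ≤ s := rearrangement_nonneg _ _ _
  have hanti := rearrangement_antitoneOn hf
  have hF : IntegrableOn F (Ioi 0) := by
    have := integrable_rearrangement hf; rwa [halfLine_eq] at this
  have hG : IntegrableOn G (Ioi 0) := by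
    have := integrable_rearrangement hg; rwa [halfLine_eq] at this
  have hFs : IntegrableOn (fun x => max (F x - s) 0) (Ioi 0) := integrable_max_sub hF hs0
  have hGs : IntegrableOn (fun x => max (G x - s) 0) (Ioi 0) := integrable_max_sub hG hs0
  have hsub : Ioc 0 r ⊆ Ioi 0 := Ioc_subset_Ioi_self
  have hcst : IntegrableOn (fun _ => s) (Ioc 0 r) := integrableOn_const (by simp)
  have hG1 : lorenz ν g r ≤ ∫ x in Ioc 0 r, (s + max (G x - s) 0) := by
    rw [lorenz_eq_setIntegral _ _ hr.le]
    refine setIntegral_mono (hG.mono_set hsub) (hcst.add (hGs.mono_set hsub)) fun x => ?_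
    change G x ≤ _
    linarith [le_max_left (G x - s) 0]
  have hG2 : ∫ x in Ioc 0 r, max (G x - s) 0 ≤ ∫ x in Ioi 0, max (G x - s) 0 :=
    setIntegral_mono_set hGs (Filter.Eventually.of_forall fun x => le_max_right _ _)
      hsub.eventuallyLE
  have hFG : ∫ x in Ioi 0, max (G x - s) 0 ≤ ∫ x in Ioi 0, max (F x - s) 0 := by
    have e1 := integral_rearrangement_max_sub hf hs0
    have e2 := integral_rearrangement_max_sub hg hs0
    rw [halfLine_eq] at e1 e2
    exact (e2.trans_le (h s hs0)).trans_eq e1.symm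
  have hF1 : ∫ x in Ioi 0, max (F x - s) 0 = ∫ x in Ioc 0 r, max (F x - s) 0 := by
    refine (setIntegral_eq_of_subset_of_forall_sdiff_eq_zero measurableSet_Ioi hsub ?_)
    intro x hx
    have hrx : r ≤ x := le_of_lt (not_le.1 fun hle => hx.2 ⟨hx.1, hle⟩)
    exact max_eq_right (sub_nonpos.2 (hanti hr (mem_Ioi.2 (hr.trans_le hrx)) hrx))
  have hF2 : ∫ x in Ioc 0 r, (s + max (F x - s) 0) = lorenz μ f r := by
    rw [lorenz_eq_setIntegral _ _ hr.le]
    refine setIntegral_congr_fun measurableSet_Ioc fun x hx => ?_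
    have : s ≤ F x := hanti (hsub hx) hr hx.2
    simp only [max_eq_left (sub_nonneg.2 this)]
    exact add_sub_cancel _ _
  rw [← hF2, integral_add hcst (hFs.mono_set hsub), ← hF1]
  rw [integral_add hcst (hGs.mono_set hsub)] at hG1
  linarith

/-! ### Monotone transport on the line -/

/-- The quantile function of a finite measure on the line, for levels strictly between `0` and the
total mass. -/
def quantile (α : Measure ℝ) (u : ℝ) : ℝ := sInf {t : ℝ | u ≤ α.real (Iic t)}

/-- The quantile function is the lower adjoint of the cumulative distribution function. -/
lemma quantile_le_iff {α : Measure ℝ} [IsFiniteMeasure α] {u : ℝ} (h0 : 0 < u)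
    (h1 : u < α.real univ) (t : ℝ) : quantile α u ≤ t ↔ u ≤ α.real (Iic t) := by
  have hmono : Monotone fun t => α.real (Iic t) := fun s t hst =>
    measureReal_mono (Iic_subset_Iic.2 hst)
  have htop : Filter.Tendsto (fun t => α.real (Iic t)) Filter.atTop (nhds (α.real univ)) :=
    (ENNReal.tendsto_toReal (measure_ne_top _ _)).comp (tendsto_measure_Iic_atTop α)
  have hbot : Filter.Tendsto (fun t => α.real (Iic t)) Filter.atBot (nhds 0) := by
    have h := tendsto_measure_iInter_atBot (μ := α)
      (fun t : ℝ => (measurableSet_Iic (a := t)).nullMeasurableSet)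
      (fun s t hst => Iic_subset_Iic.2 hst) ⟨0, measure_ne_top _ _⟩
    rw [iInter_Iic_eq_empty_iff.2 (by simp [not_bddBelow_univ]), measure_empty] at h
    exact (ENNReal.tendsto_toReal ENNReal.zero_ne_top).comp h
  have hne : {t : ℝ | u ≤ α.real (Iic t)}.Nonempty :=
    ((htop.eventually_const_lt h1).exists).imp fun t ht => le_of_lt ht
  have hbdd : BddBelow {t : ℝ | u ≤ α.real (Iic t)} := by
    obtain ⟨s, hs⟩ := (hbot.eventually_lt_const h0).exists
    exact ⟨s, fun t ht => le_of_lt (hmono.reflect_lt (hs.trans_le ht))⟩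
  refine ⟨fun h => ?_, fun h => csInf_le hbdd h⟩
  have hgt : ∀ n : ℕ, u ≤ α.real (Iic (t + 1 / ((n : ℝ) + 1))) := fun n => by
    obtain ⟨s, hs, hst⟩ := exists_lt_of_csInf_lt hne
      (lt_of_le_of_lt h (lt_add_of_pos_right t (Nat.one_div_pos_of_nat (n := n))))
    exact (show u ≤ _ from hs).trans (hmono hst.le)
  have hI : Iic t = ⋂ n : ℕ, Iic (t + 1 / ((n : ℝ) + 1)) := by
    ext x
    simp only [mem_Iic, mem_iInter]
    refine ⟨fun hx n => hx.trans (le_add_of_nonneg_right Nat.one_div_pos_of_nat.le), fun hx => ?_⟩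
    refine le_of_forall_pos_le_add fun ε hε => ?_
    obtain ⟨n, hn⟩ := exists_nat_one_div_lt hε
    linarith [hx n]
  have hanti : Antitone fun n : ℕ => Iic (t + 1 / ((n : ℝ) + 1)) := fun m n hmn =>
    Iic_subset_Iic.2 (add_le_add_right (Nat.one_div_le_one_div hmn) t)
  have hlim := tendsto_measure_iInter_atTop (μ := α)
    (fun n : ℕ => (measurableSet_Iic (a := t + 1 / ((n : ℝ) + 1))).nullMeasurableSet) hanti
    ⟨0, measure_ne_top _ _⟩
  rw [← hI] at hlim
  exact ge_of_tendsto' ((ENNReal.tendsto_toReal (measure_ne_top _ _)).comp hlim) hgt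

lemma aemeasurable_quantile (α : Measure ℝ) [IsFiniteMeasure α] :
    AEMeasurable (quantile α) (volume.restrict (Ioo 0 (α.real univ))) := by
  refine aemeasurable_restrict_of_monotoneOn measurableSet_Ioo fun u hu v hv huv => ?_
  exact (quantile_le_iff hu.1 hu.2 _).2 (huv.trans ((quantile_le_iff hv.1 hv.2 _).1 le_rfl))

/-- The quantile function pushes Lebesgue measure on `(0, α(ℝ))` forward to `α`. -/
lemma map_quantile (α : Measure ℝ) [IsFiniteMeasure α] :
    (volume.restrict (Ioo 0 (α.real univ))).map (quantile α) = α := by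
  have hfin : IsFiniteMeasure (volume.restrict (Ioo 0 (α.real univ))) :=
    ⟨by simp⟩
  refine Measure.ext_of_Iic _ _ fun t => ?_
  set a := α.real (Iic t)
  have ha : a ≤ α.real univ := measureReal_mono (subset_univ _)
  have hset : (quantile α ⁻¹' Iic t) ∩ Ioo 0 (α.real univ) = Iic a ∩ Ioo 0 (α.real univ) := by
    ext u
    exact and_congr_left fun hu => quantile_le_iff hu.1 hu.2 t
  rw [Measure.map_apply_of_aemeasurable (aemeasurable_quantile α) measurableSet_Iic,
    Measure.restrict_apply' measurableSet_Ioo, hset]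
  have hv : volume (Iic a ∩ Ioo 0 (α.real univ)) = ENNReal.ofReal a := by
    refine le_antisymm ?_ ?_
    · refine (measure_mono (t := Ioc 0 a) fun u hu => ⟨hu.2.1, hu.1⟩).trans ?_
      rw [Real.volume_Ioc, sub_zero]
    · refine le_trans ?_ (measure_mono (s := Ioo 0 a) fun u hu =>
        ⟨hu.2.le, hu.1, hu.2.trans_le ha⟩)
      rw [Real.volume_Ioo, sub_zero]
  rw [hv, ofReal_measureReal]

/-- If `β` lies stochastically to the right of `α` (and may have less mass), then `β` can be
reached from a part of `α` by moving mass to the right only. -/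
lemma exists_rightward_transport (α β : Measure ℝ) [IsFiniteMeasure α] [IsFiniteMeasure β]
    (h : ∀ t, β (Iic t) ≤ α (Iic t)) :
    ∃ γ : Measure (ℝ × ℝ), γ.map Prod.fst ≤ α ∧ γ.map Prod.snd = β ∧ ∀ᵐ z ∂γ, z.1 ≤ z.2 := by
  have hM : β.real univ ≤ α.real univ :=
    ENNReal.toReal_mono (measure_ne_top _ _)
      (le_of_tendsto_of_tendsto' (tendsto_measure_Iic_atTop β) (tendsto_measure_Iic_atTop α) h)
  set m : Measure ℝ := volume.restrict (Ioo 0 (β.real univ))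
  have hle : m ≤ volume.restrict (Ioo 0 (α.real univ)) :=
    Measure.restrict_mono (Ioo_subset_Ioo_right hM) le_rfl
  have hα : AEMeasurable (quantile α) m := (aemeasurable_quantile α).mono_measure hle
  have hβ : AEMeasurable (quantile β) m := aemeasurable_quantile β
  refine ⟨m.map fun u => (quantile α u, quantile β u), ?_, ?_, ?_⟩
  · rw [AEMeasurable.map_map_of_aemeasurable measurable_fst.aemeasurable (hα.prodMk hβ)]
    calc m.map (quantile α) ≤ (volume.restrict (Ioo 0 (α.real univ))).map (quantile α) := by
          refine Measure.le_iff.2 fun B hB => ?_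
          rw [Measure.map_apply_of_aemeasurable hα hB,
            Measure.map_apply_of_aemeasurable (aemeasurable_quantile α) hB]
          exact hle _
      _ = α := map_quantile α
  · rw [AEMeasurable.map_map_of_aemeasurable measurable_snd.aemeasurable (hα.prodMk hβ)]
    exact map_quantile β
  · rw [ae_map_iff (hα.prodMk hβ) (measurableSet_le measurable_fst measurable_snd)]
    refine (ae_restrict_iff' measurableSet_Ioo).2 (Filter.Eventually.of_forall fun u hu => ?_)
    refine (quantile_le_iff hu.1 (hu.2.trans_le hM) _).2 ?_
    exact ((quantile_le_iff hu.1 hu.2 _).1 le_rfl).trans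
      (ENNReal.toReal_mono (measure_ne_top _ _) (h _))

/-- A measure below a `σ`-finite measure has a complement. -/
lemma exists_add_eq_of_le {m l : Measure X} [SigmaFinite l] (h : m ≤ l) : ∃ τ, τ + m = l := by
  have : SigmaFinite m := Measure.sigmaFinite_of_le l h
  have hm : l.withDensity (m.rnDeriv l) = m :=
    Measure.withDensity_rnDeriv_eq _ _ (Measure.absolutelyContinuous_of_le h)
  refine ⟨l.withDensity fun x => 1 - m.rnDeriv l x, ?_⟩
  nth_rewrite 2 [← hm]
  rw [← withDensity_add_right _ (Measure.measurable_rnDeriv m l)]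
  have e : (fun x => 1 - m.rnDeriv l x) + m.rnDeriv l =ᵐ[l] 1 := by
    filter_upwards [Measure.rnDeriv_le_one_of_le h] with x hx
    exact tsub_add_cancel_of_le hx
  rw [withDensity_congr_ae e, withDensity_one]

/-! ### The exchange coupling -/

lemma ofReal_add_ofReal_sub {a b : ℝ} (ha : 0 ≤ a) (hb : 0 ≤ b) :
    ENNReal.ofReal a + ENNReal.ofReal (b - a) = ENNReal.ofReal b + ENNReal.ofReal (a - b) := by
  rcases le_total a b with h | h
  · rw [ENNReal.ofReal_of_nonpos (sub_nonpos.2 h), add_zero,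
      ← ENNReal.ofReal_add ha (sub_nonneg.2 h), add_sub_cancel]
  · rw [ENNReal.ofReal_of_nonpos (sub_nonpos.2 h), add_zero,
      ← ENNReal.ofReal_add hb (sub_nonneg.2 h), add_sub_cancel]

/-- Let `f` and `g` be nonnegative on the half-line with `∫₀ᵗ g ≤ ∫₀ᵗ f` for all `t`, and let `g` be
decreasing. There is a of Lebesgue measure with itself that averages `f` to at least `g`.

Transport the deficit `(g - f)₊` from the excess `(f - g)₊` by a plan `γ` that moves mass to the
right. Where `γ` sends `x` to `y`, one has `f x > g x ≥ g y > f y`, so exchanging the amount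
`dγ / (f x - f y)` of mass between `x` and `y` brings the averages of `f` at both points to `g`,
and these amounts add up to at most the available Lebesgue measure. -/
theorem exists_exchange_coupling {f g : ℝ → ℝ} (hfm : Measurable f) (hgm : Measurable g)
    (hf0 : ∀ x, 0 ≤ f x) (hg0 : ∀ x, 0 ≤ g x) (hg : AntitoneOn g (Ioi 0))
    (hfi : Integrable f halfLine) (hgi : Integrable g halfLine)
    (h : ∀ t, 0 < t → ∫ x in Ioc 0 t, g x ≤ ∫ x in Ioc 0 t, f x) :
    ∃ π : Measure (ℝ × ℝ), π.map Prod.fst = halfLine ∧ π.map Prod.snd = halfLine ∧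
      ∀ D, MeasurableSet D → ∫⁻ x in D, ENNReal.ofReal (g x) ∂halfLine
        ≤ ∫⁻ z in Prod.snd ⁻¹' D, ENNReal.ofReal (f z.1) ∂π := by
  set l : Measure ℝ := halfLine with hl
  set w₁ : ℝ → ℝ≥0∞ := fun x => ENNReal.ofReal (f x - g x)
  set w₂ : ℝ → ℝ≥0∞ := fun x => ENNReal.ofReal (g x - f x)
  have hw₁m : Measurable w₁ := (hfm.sub hgm).ennreal_ofReal
  have hw₂m : Measurable w₂ := (hgm.sub hfm).ennreal_ofReal
  set α := l.withDensity w₁ with hα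
  set β := l.withDensity w₂ with hβ
  have : IsFiniteMeasure α := isFiniteMeasure_withDensity_ofReal (hfi.sub hgi).2
  have : IsFiniteMeasure β := isFiniteMeasure_withDensity_ofReal (hgi.sub hfi).2
  have hbal : ∀ D, MeasurableSet D → ∫⁻ x in D, ENNReal.ofReal (f x) ∂l + β D
      = ∫⁻ x in D, ENNReal.ofReal (g x) ∂l + α D := fun D hD => by
    rw [hα, hβ, withDensity_apply _ hD, withDensity_apply _ hD,
      ← lintegral_add_right _ hw₂m, ← lintegral_add_right _ hw₁m]
    exact lintegral_congr fun x => ofReal_add_ofReal_sub (hf0 x) (hg0 x)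
  have hdom : ∀ t, β (Iic t) ≤ α (Iic t) := fun t => by
    have hle : ∫⁻ x in Iic t, ENNReal.ofReal (g x) ∂l
        ≤ ∫⁻ x in Iic t, ENNReal.ofReal (f x) ∂l := by
      have hI : l.restrict (Iic t) = volume.restrict (Ioc 0 t) := by
        rw [hl, halfLine_eq, Measure.restrict_restrict measurableSet_Iic, inter_comm, Ioi_inter_Iic]
      have hIf : ∀ {k : ℝ → ℝ}, Integrable k l → IntegrableOn k (Ioc 0 t) := fun hk => by
        have := hk.integrableOn (s := Iic t)
        rwa [IntegrableOn, hI] at this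
      rw [hI]
      rcases le_or_gt t 0 with ht | ht
      · rw [Ioc_eq_empty ht.not_gt]; simp
      rw [← ofReal_integral_eq_lintegral_ofReal (hIf hfi) (Filter.Eventually.of_forall hf0),
        ← ofReal_integral_eq_lintegral_ofReal (hIf hgi) (Filter.Eventually.of_forall hg0)]
      exact ENNReal.ofReal_le_ofReal (h t ht)
    have hfin : ∫⁻ x in Iic t, ENNReal.ofReal (f x) ∂l ≠ ∞ :=
      ((setLIntegral_le_lintegral _ _).trans_lt ((hasFiniteIntegral_iff_ofReal
        (Filter.Eventually.of_forall hf0)).1 hfi.2)).ne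
    refine ENNReal.le_of_add_le_add_left hfin ?_
    rw [hbal _ measurableSet_Iic]
    exact add_le_add_left hle _
  obtain ⟨γ, hγ1, hγ2, hγle⟩ := exists_rightward_transport α β hdom
  have hpos : ∀ᵐ x ∂l, 0 < x := by
    rw [hl, halfLine_eq]; exact ae_restrict_mem measurableSet_Ioi
  have hA : ∀ᵐ x ∂α, 0 < x ∧ g x < f x := by
    rw [hα, ae_withDensity_iff hw₁m]
    filter_upwards [hpos] with x hx hne
    exact ⟨hx, sub_pos.1 (ENNReal.ofReal_pos.1 (pos_iff_ne_zero.2 hne))⟩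
  have hB : ∀ᵐ x ∂β, 0 < x ∧ f x < g x := by
    rw [hβ, ae_withDensity_iff hw₂m]
    filter_upwards [hpos] with x hx hne
    exact ⟨hx, sub_pos.1 (ENNReal.ofReal_pos.1 (pos_iff_ne_zero.2 hne))⟩
  have hγ : ∀ᵐ z ∂γ, g z.2 ≤ g z.1 ∧ g z.1 < f z.1 ∧ f z.2 < g z.2 := by
    filter_upwards [hγle, ae_comp_of_map_le measurable_fst hγ1 hA,
      ae_comp_of_map_le measurable_snd hγ2.le hB] with z h1 h2 h3
    exact ⟨hg h2.1 h3.1 h1, h2.2, h3.2⟩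
  set δ : ℝ × ℝ → ℝ≥0∞ := fun z => ENNReal.ofReal (f z.1 - f z.2) with hδ
  have hδm : Measurable δ :=
    ((hfm.comp measurable_fst).sub (hfm.comp measurable_snd)).ennreal_ofReal
  set σ := γ.withDensity fun z => (δ z)⁻¹ with hσ
  have hσac : σ ≪ γ := withDensity_absolutelyContinuous _ _
  have hδγ : ∀ E, MeasurableSet E → ∫⁻ z in E, δ z ∂σ = γ E := fun E hE => by
    rw [hσ]
    refine (setLIntegral_withDensity_eq_setLIntegral_mul _ hδm.inv hδm hE).trans ?_
    rw [← setLIntegral_one]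
    refine lintegral_congr_ae (ae_restrict_of_ae ?_)
    filter_upwards [hγ] with z hz
    refine ENNReal.inv_mul_cancel ?_ ENNReal.ofReal_ne_top
    exact (ENNReal.ofReal_pos.2 (sub_pos.2 (by linarith [hz.1, hz.2.1, hz.2.2]))).ne'
  -- The amounts exchanged at a point fit into Lebesgue measure.
  have hσ1 : ∀ D, MeasurableSet D → σ.map Prod.fst D ≤ ∫⁻ x in D, w₁ x * (w₁ x)⁻¹ ∂l := by
    intro D hD
    rw [Measure.map_apply measurable_fst hD, hσ, withDensity_apply _ (measurable_fst hD)]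
    calc ∫⁻ z in Prod.fst ⁻¹' D, (δ z)⁻¹ ∂γ ≤ ∫⁻ z in Prod.fst ⁻¹' D, (w₁ z.1)⁻¹ ∂γ := by
          refine lintegral_mono_ae (ae_restrict_of_ae ?_)
          filter_upwards [hγ] with z hz
          exact ENNReal.inv_le_inv.2 (ENNReal.ofReal_le_ofReal (by linarith [hz.1, hz.2.2]))
      _ = ∫⁻ x in D, (w₁ x)⁻¹ ∂(γ.map Prod.fst) :=
          (setLIntegral_map hD hw₁m.inv measurable_fst).symm
      _ ≤ ∫⁻ x in D, (w₁ x)⁻¹ ∂α := lintegral_mono' (Measure.restrict_mono le_rfl hγ1) le_rfl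
      _ = _ := setLIntegral_withDensity_eq_setLIntegral_mul _ hw₁m hw₁m.inv hD
  have hσ2 : ∀ D, MeasurableSet D → σ.map Prod.snd D ≤ ∫⁻ x in D, w₂ x * (w₂ x)⁻¹ ∂l := by
    intro D hD
    rw [Measure.map_apply measurable_snd hD, hσ, withDensity_apply _ (measurable_snd hD)]
    calc ∫⁻ z in Prod.snd ⁻¹' D, (δ z)⁻¹ ∂γ ≤ ∫⁻ z in Prod.snd ⁻¹' D, (w₂ z.2)⁻¹ ∂γ := by
          refine lintegral_mono_ae (ae_restrict_of_ae ?_)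
          filter_upwards [hγ] with z hz
          exact ENNReal.inv_le_inv.2 (ENNReal.ofReal_le_ofReal (by linarith [hz.1, hz.2.1]))
      _ = ∫⁻ x in D, (w₂ x)⁻¹ ∂(γ.map Prod.snd) :=
          (setLIntegral_map hD hw₂m.inv measurable_snd).symm
      _ = ∫⁻ x in D, (w₂ x)⁻¹ ∂β := by rw [hγ2]
      _ = _ := setLIntegral_withDensity_eq_setLIntegral_mul _ hw₂m hw₂m.inv hD
  have hle : σ.map Prod.fst + σ.map Prod.snd ≤ l := Measure.le_iff.2 fun D hD => by
    refine (add_le_add (hσ1 D hD) (hσ2 D hD)).trans ?_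
    rw [← lintegral_add_left (f := fun x => w₁ x * (w₁ x)⁻¹) (hw₁m.mul hw₁m.inv),
      ← setLIntegral_one]
    refine lintegral_mono fun x => ?_
    rcases le_total (f x) (g x) with hx | hx
    · have : w₁ x = 0 := ENNReal.ofReal_of_nonpos (sub_nonpos.2 hx)
      simp only [this, zero_mul, zero_add]
      exact ENNReal.mul_inv_le_one _
    · have : w₂ x = 0 := ENNReal.ofReal_of_nonpos (sub_nonpos.2 hx)
      simp only [this, zero_mul, add_zero]
      exact ENNReal.mul_inv_le_one _
  obtain ⟨τ, hτ⟩ := exists_add_eq_of_le hle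
  have hdiag : Measurable fun x : ℝ => (x, x) := measurable_id.prodMk measurable_id
  -- Mass that takes part in no exchange stays in place, on the diagonal.
  refine ⟨τ.map (fun x => (x, x)) + (σ + σ.map Prod.swap), ?_, ?_, fun D hD => ?_⟩
  · rw [Measure.map_add _ _ measurable_fst, Measure.map_add _ _ measurable_fst,
      Measure.map_map measurable_fst hdiag, Measure.map_map measurable_fst measurable_swap, ← hτ]
    congr 1
    exact Measure.map_id
  · rw [Measure.map_add _ _ measurable_snd, Measure.map_add _ _ measurable_snd,
      Measure.map_map measurable_snd hdiag, Measure.map_map measurable_snd measurable_swap, ← hτ,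
      add_comm (σ.map Prod.snd)]
    congr 1
    exact Measure.map_id
  · have hfm' : Measurable fun x => ENNReal.ofReal (f x) := hfm.ennreal_ofReal
    have hD1 : MeasurableSet (Prod.fst ⁻¹' D : Set (ℝ × ℝ)) := measurable_fst hD
    have hD2 : MeasurableSet (Prod.snd ⁻¹' D : Set (ℝ × ℝ)) := measurable_snd hD
    have hfm1 : Measurable fun z : ℝ × ℝ => ENNReal.ofReal (f z.1) := hfm'.comp measurable_fst
    have hfδ : ∀ᵐ z ∂σ, ENNReal.ofReal (f z.1) = ENNReal.ofReal (f z.2) + δ z := by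
      filter_upwards [hσac.ae_le hγ] with z hz
      rw [hδ, ← ENNReal.ofReal_add (hf0 _) (by linarith [hz.1, hz.2.1, hz.2.2]), add_sub_cancel]
    have hsplit : ∀ E, MeasurableSet E → ∫⁻ z in E, ENNReal.ofReal (f z.1) ∂σ
        = ∫⁻ z in E, ENNReal.ofReal (f z.2) ∂σ + γ E := fun E hE => by
      rw [lintegral_congr_ae (ae_restrict_of_ae hfδ), lintegral_add_right _ hδm, hδγ E hE]
    have hX : ∫⁻ z in Prod.snd ⁻¹' D, ENNReal.ofReal (f z.1)
          ∂(τ.map (fun x => (x, x)) + (σ + σ.map Prod.swap))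
        = ∫⁻ x in D, ENNReal.ofReal (f x) ∂τ + (∫⁻ z in Prod.snd ⁻¹' D, ENNReal.ofReal (f z.1) ∂σ
          + ∫⁻ z in Prod.fst ⁻¹' D, ENNReal.ofReal (f z.2) ∂σ) := by
      rw [Measure.restrict_add, Measure.restrict_add, lintegral_add_measure,
        lintegral_add_measure, setLIntegral_map hD2 hfm1 hdiag,
        setLIntegral_map hD2 hfm1 measurable_swap]
      rfl
    have hF : ∫⁻ x in D, ENNReal.ofReal (f x) ∂l
        = ∫⁻ x in D, ENNReal.ofReal (f x) ∂τ + (∫⁻ z in Prod.fst ⁻¹' D, ENNReal.ofReal (f z.1) ∂σ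
          + ∫⁻ z in Prod.snd ⁻¹' D, ENNReal.ofReal (f z.2) ∂σ) := by
      rw [← hτ, Measure.restrict_add, Measure.restrict_add, lintegral_add_measure,
        lintegral_add_measure, setLIntegral_map hD hfm' measurable_fst,
        setLIntegral_map hD hfm' measurable_snd]
    have hb := hbal D hD
    rw [hF, hsplit _ hD1] at hb
    rw [hX, hsplit _ hD2]
    have hγ1D : γ (Prod.fst ⁻¹' D) ≤ α D := by
      rw [← Measure.map_apply measurable_fst hD]; exact hγ1 D
    have hγ2D : γ (Prod.snd ⁻¹' D) = β D := by
      rw [← Measure.map_apply measurable_snd hD, hγ2]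
    refine ENNReal.le_of_add_le_add_right
      (ne_top_of_le_ne_top (measure_ne_top α D) hγ1D) ?_
    refine (add_le_add_right hγ1D _).trans (hb.symm.le.trans (le_of_eq ?_))
    rw [hγ2D]
    ring

/-! ### Coupling a function with its decreasing rearrangement -/

/-- The analogue of `Measure.ext_of_Iic` for measures that need not be finite. -/
lemma ext_of_Iic_of_ne_top {m m' : Measure ℝ} (hfin : ∀ r, m (Iic r) ≠ ∞)
    (h : ∀ r, m (Iic r) = m' (Iic r)) : m = m' := by
  refine Measure.ext_of_Ioc' m m' (fun a b _ => ne_top_of_le_ne_top (hfin b)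
    (measure_mono Ioc_subset_Iic_self)) fun a b hab => ?_
  rw [← Iic_sdiff_Iic, measure_sdiff (Iic_subset_Iic.2 hab.le) nullMeasurableSet_Iic (hfin a),
    measure_sdiff (Iic_subset_Iic.2 hab.le) nullMeasurableSet_Iic (h a ▸ hfin a), h, h]

section Spread

variable {μ : Measure X} {f : X → ℝ}

lemma measure_ge_ne_top (hf : Integrable f μ) {t : ℝ} (ht : 0 < t) : μ {x | t ≤ f x} ≠ ∞ := by
  refine ne_top_of_le_ne_top (hf.measure_norm_ge_lt_top ht).ne
    (measure_mono fun x (hx : t ≤ f x) => ?_)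
  exact hx.trans (le_abs_self _)

lemma distribution_ne_top (hf : Integrable f μ) {t : ℝ} (ht : 0 < t) : distribution μ f t ≠ ∞ :=
  ne_top_of_le_ne_top (measure_ge_ne_top hf ht) (measure_mono fun x (hx : t < f x) => hx.le)

/-- The map that spreads the level set `[f = t]` over the interval from `μ [f > t]` to `μ [f ≥ t]`,
with an auxiliary uniform variable `u ∈ [0, 1]` as the position inside the interval. -/
def spread (μ : Measure X) (f : X → ℝ) (z : X × ℝ) : ℝ :=
  (1 - z.2) * (distribution μ f (f z.1)).toReal + z.2 * (μ {x | f z.1 ≤ f x}).toReal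

lemma measurable_spread (hfm : Measurable f) : Measurable (spread μ f) := by
  have h1 : Antitone fun t => distribution μ f t := fun s t hst =>
    measure_mono fun x (hx : t < f x) => lt_of_le_of_lt hst hx
  have h2 : Antitone fun t => μ {x | t ≤ f x} := fun s t hst =>
    measure_mono fun x (hx : t ≤ f x) => hst.trans hx
  have hf1 : Measurable fun z : X × ℝ => f z.1 := hfm.comp measurable_fst
  exact ((measurable_const.sub measurable_snd).mul
    (h1.measurable.comp hf1).ennreal_toReal).add
    (measurable_snd.mul (h2.measurable.comp hf1).ennreal_toReal)

lemma spread_mem_Icc (hf : Integrable f μ) {z : X × ℝ} (h0 : 0 < f z.1) (hz : z.2 ∈ Icc 0 1) :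
    (distribution μ f (f z.1)).toReal ≤ spread μ f z ∧
      spread μ f z ≤ (μ {x | f z.1 ≤ f x}).toReal := by
  have h : (distribution μ f (f z.1)).toReal ≤ (μ {x | f z.1 ≤ f x}).toReal :=
    ENNReal.toReal_mono (measure_ge_ne_top hf h0) (measure_mono fun x (hx : f z.1 < f x) => hx.le)
  unfold spread
  constructor <;> nlinarith [hz.1, hz.2]

/-- The base space of the spreading map: the set where `f > 0`, times the unit interval. -/
def spreadBase (μ : Measure X) (f : X → ℝ) : Measure (X × ℝ) :=
  (μ.restrict {x | 0 < f x}).prod (volume.restrict (Icc 0 1))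

lemma ae_spreadBase [SigmaFinite μ] (hfm : Measurable f) :
    ∀ᵐ z ∂spreadBase μ f, 0 < f z.1 ∧ z.2 ∈ Icc (0 : ℝ) 1 := by
  rw [spreadBase, Measure.prod_restrict]
  exact ae_restrict_mem ((measurableSet_lt measurable_const hfm).prod measurableSet_Icc)

lemma map_fst_spreadBase [SigmaFinite μ] :
    (spreadBase μ f).map Prod.fst = μ.restrict {x | 0 < f x} := by
  rw [spreadBase, Measure.map_fst_prod]
  simp

/-- At the level `s = f↓(r) > 0` the measure of `[f ≥ s]` is at least `r`, by continuity of `μ`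
along the sets `[f > s']` with `s' < s`, which have finite measure for `s' > 0`. -/
lemma le_measure_ge_rearrangement (hfm : Measurable f) (hf : Integrable f μ) {r : ℝ} (hr : 0 < r)
    (hs : 0 < rearrangement μ f r) :
    ENNReal.ofReal r ≤ μ {x | rearrangement μ f r ≤ f x} := by
  set s := rearrangement μ f r
  have hpos : ∀ n : ℕ, 0 < s / 2 * (1 / ((n : ℝ) + 1)) := fun n =>
    mul_pos (half_pos hs) Nat.one_div_pos_of_nat
  have hle1 : ∀ n : ℕ, s / 2 * (1 / ((n : ℝ) + 1)) ≤ s / 2 := fun n =>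
    mul_le_of_le_one_right (half_pos hs).le (by
      rw [div_le_one (by positivity)]; linarith [n.cast_nonneg (α := ℝ)])
  have hI : {x | s ≤ f x} = ⋂ n : ℕ, {x | s - s / 2 * (1 / ((n : ℝ) + 1)) < f x} := by
    ext x
    simp only [mem_ofPred_eq, mem_iInter]
    refine ⟨fun hx n => by linarith [hpos n], fun hx => ?_⟩
    refine le_of_forall_pos_le_add fun ε hε => ?_
    obtain ⟨n, hn⟩ := exists_nat_one_div_lt (div_pos hε (half_pos hs))
    have := hx n
    rw [lt_div_iff₀ (half_pos hs)] at hn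
    linarith
  have hanti : Antitone fun n : ℕ => {x | s - s / 2 * (1 / ((n : ℝ) + 1)) < f x} := by
    intro m n hmn x hx
    have := mul_le_mul_of_nonneg_left (Nat.one_div_le_one_div (α := ℝ) hmn) (half_pos hs).le
    simp only [mem_ofPred_eq] at hx ⊢
    linarith
  have hlim := tendsto_measure_iInter_atTop (μ := μ)
    (fun n : ℕ => (measurableSet_lt measurable_const hfm).nullMeasurableSet) hanti
    ⟨0, distribution_ne_top hf (by linarith [hle1 0])⟩
  rw [← hI] at hlim
  refine ge_of_tendsto' hlim fun n => ?_
  exact ((lt_rearrangement_iff hf hr (by linarith [hle1 n])).1 (by linarith [hpos n])).le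

/-- The part of `[0, 1]` where `(1 - u) a + u b ≤ r`, for `a ≤ r ≤ b`, has length
`(r - a) / (b - a)`. -/
lemma volume_mul_eq_sub {a b r : ℝ} (har : a ≤ r) (hrb : r ≤ b) :
    volume ({u : ℝ | (1 - u) * a + u * b ≤ r} ∩ Icc 0 1) * ENNReal.ofReal (b - a)
      = ENNReal.ofReal (r - a) := by
  rcases eq_or_lt_of_le (har.trans hrb) with h | h
  · have : r = a := le_antisymm (hrb.trans h.ge) har
    simp [h, this]
  · have hba : 0 < b - a := sub_pos.2 h
    have e : {u : ℝ | (1 - u) * a + u * b ≤ r} ∩ Icc 0 1 = Icc 0 ((r - a) / (b - a)) := by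
      ext u
      have hu : u ≤ (r - a) / (b - a) ↔ (1 - u) * a + u * b ≤ r := by
        rw [le_div_iff₀ hba]
        constructor <;> intro hu <;> nlinarith
      have h1 : (r - a) / (b - a) ≤ 1 := (div_le_one hba).2 (by linarith)
      simp only [mem_inter_iff, mem_ofPred_eq, mem_Icc, ← hu]
      exact ⟨fun h => ⟨h.2.1, h.1⟩, fun h => ⟨h.2, h.1, h.2.trans h1⟩⟩
    rw [e, Real.volume_Icc, sub_zero, ← ENNReal.ofReal_mul (div_nonneg (by linarith) hba.le),
      div_mul_cancel₀ _ hba.ne']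

/-- The measure of `[spread ≤ r]`, for levels `r` below the measure of the support: the level `s`
of the rearrangement at `r` contributes `[f > s]` and a part of `[f = s]`. -/
lemma spreadBase_spread_le [SigmaFinite μ] (hfm : Measurable f) (hf : Integrable f μ) {r : ℝ}
    (hr : 0 < r) (hra : ENNReal.ofReal r < distribution μ f 0) :
    spreadBase μ f (spread μ f ⁻¹' Iic r) = ENNReal.ofReal r := by
  set s := rearrangement μ f r with hsdef
  have hs : 0 < s := (lt_rearrangement_iff hf hr le_rfl).2 hra
  have hDs : distribution μ f s ≤ ENNReal.ofReal r :=
    not_lt.1 fun h => lt_irrefl s ((lt_rearrangement_iff hf hr hs.le).2 h)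
  have hDs' := le_measure_ge_rearrangement hfm hf hr hs
  rw [← hsdef] at hDs'
  have hfin := distribution_ne_top hf hs
  have hfin' := measure_ge_ne_top hf hs
  set a := (distribution μ f s).toReal with ha
  set b := (μ {x | s ≤ f x}).toReal with hb
  have har : a ≤ r := ENNReal.toReal_le_of_le_ofReal hr.le hDs
  have hrb : r ≤ b := (ENNReal.ofReal_le_iff_le_toReal hfin').1 hDs'
  set c := volume ({u : ℝ | (1 - u) * a + u * b ≤ r} ∩ Icc 0 1) with hc
  have hm1 : MeasurableSet {x | s < f x} := measurableSet_lt measurable_const hfm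
  have hm2 : MeasurableSet {x | f x = s} := hfm (measurableSet_singleton s)
  have hμeq : μ {x | f x = s} = ENNReal.ofReal (b - a) := by
    have e : {x | f x = s} = {x | s ≤ f x} \ {x | s < f x} := by
      ext x; simp [le_antisymm_iff, and_comm]
    have hba : distribution μ f s = μ {x | s < f x} := rfl
    have hsub : {x | s < f x} ⊆ {x | s ≤ f x} := fun x (hx : s < f x) => hx.le
    rw [e, measure_sdiff hsub hm1.nullMeasurableSet hfin, ← hba,
      ENNReal.ofReal_sub _ ENNReal.toReal_nonneg, hb, ENNReal.ofReal_toReal hfin,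
      ENNReal.ofReal_toReal hfin']
  rw [spreadBase, Measure.prod_apply (measurable_spread hfm measurableSet_Iic)]
  have hin : ∀ x, 0 < f x → (volume.restrict (Icc (0 : ℝ) 1))
      (Prod.mk x ⁻¹' (spread μ f ⁻¹' Iic r))
      = {x | s < f x}.indicator (fun _ => 1) x + {x | f x = s}.indicator (fun _ => c) x := by
    intro x hx
    rw [Measure.restrict_apply' measurableSet_Icc]
    rcases lt_trichotomy (f x) s with h | h | h
    · have he : Prod.mk x ⁻¹' (spread μ f ⁻¹' Iic r) ∩ Icc 0 1 = ∅ := by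
        refine eq_empty_iff_forall_notMem.2 fun u hu => ?_
        have h1 := (spread_mem_Icc hf (z := (x, u)) hx hu.2).1.trans hu.1
        have h2 := (lt_rearrangement_iff hf hr hx.le).1 h
        exact h2.not_ge ((ENNReal.le_ofReal_iff_toReal_le (distribution_ne_top hf hx) hr.le).2 h1)
      rw [he, measure_empty, indicator_of_notMem (by simpa using h.le),
        indicator_of_notMem (by simpa using h.ne), add_zero]
    · rw [indicator_of_notMem (by simp [h]), indicator_of_mem (by simpa using h), zero_add, hc]
      congr 2
      ext u
      simp only [spread, mem_preimage, mem_Iic, mem_ofPred_eq, h, ha, hb]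
    · have he : Prod.mk x ⁻¹' (spread μ f ⁻¹' Iic r) ∩ Icc 0 1 = Icc 0 1 := by
        refine inter_eq_right.2 fun u hu => ?_
        have h1 := (spread_mem_Icc hf (z := (x, u)) hx hu).2
        refine h1.trans (ENNReal.toReal_le_of_le_ofReal hr.le (le_trans ?_ hDs))
        exact measure_mono fun y hy => lt_of_lt_of_le h hy
      rw [he, Real.volume_Icc, indicator_of_mem (by simpa using h),
        indicator_of_notMem (by simpa using h.ne'), add_zero]
      simp
  have hsub1 : {x | s < f x} ⊆ {x | 0 < f x} := fun x (hx : s < f x) => hs.trans hx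
  have hsub2 : {x | f x = s} ⊆ {x | 0 < f x} := fun x (hx : f x = s) => hs.trans_eq hx.symm
  rw [setLIntegral_congr_fun (measurableSet_lt measurable_const hfm) hin,
    lintegral_add_left (measurable_const.indicator hm1), lintegral_indicator hm1,
    lintegral_indicator hm2, setLIntegral_one, setLIntegral_const,
    Measure.restrict_apply hm1, Measure.restrict_apply hm2,
    inter_eq_left.2 hsub1, inter_eq_left.2 hsub2, hμeq, hc,
    volume_mul_eq_sub har hrb]
  have hba : distribution μ f s = μ {x | s < f x} := rfl
  rw [← hba, ← ENNReal.ofReal_toReal hfin, ← ha,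
    ← ENNReal.ofReal_add ENNReal.toReal_nonneg (sub_nonneg.2 har), add_sub_cancel]

/-- The spreading map carries the support of `f` to the interval `[0, μ (supp f))`. -/
lemma map_spread [SigmaFinite μ] (hfm : Measurable f) (hf : Integrable f μ) :
    (spreadBase μ f).map (spread μ f)
      = halfLine.restrict {r | ENNReal.ofReal r < distribution μ f 0} := by
  have hsp := measurable_spread (μ := μ) hfm
  have hpos : ∀ r, 0 < r → (spreadBase μ f).map (spread μ f) (Iic r)
      = halfLine.restrict {r | ENNReal.ofReal r < distribution μ f 0} (Iic r) := by
    intro r hr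
    rw [Measure.map_apply hsp measurableSet_Iic, Measure.restrict_apply measurableSet_Iic,
      Measure.restrict_apply' measurableSet_Ici]
    rcases lt_or_ge (ENNReal.ofReal r) (distribution μ f 0) with h | h
    · have e : Iic r ∩ {r | ENNReal.ofReal r < distribution μ f 0} ∩ Ici 0 = Icc 0 r := by
        ext x
        refine ⟨fun hx => ⟨hx.2, hx.1.1⟩, fun hx => ⟨⟨hx.2, ?_⟩, hx.1⟩⟩
        exact (ENNReal.ofReal_le_ofReal hx.2).trans_lt h
      rw [spreadBase_spread_le hfm hf hr h, e, Real.volume_Icc, sub_zero]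
    · have hfin : distribution μ f 0 ≠ ∞ := ne_top_of_le_ne_top ENNReal.ofReal_ne_top h
      have e : Iic r ∩ {r | ENNReal.ofReal r < distribution μ f 0} ∩ Ici 0
          = Ico 0 (distribution μ f 0).toReal := by
        ext x
        refine ⟨fun hx => ⟨hx.2, (ENNReal.ofReal_lt_iff_lt_toReal hx.2 hfin).1 hx.1.2⟩,
          fun hx => ⟨⟨?_, (ENNReal.ofReal_lt_iff_lt_toReal hx.1 hfin).2 hx.2⟩, hx.1⟩⟩
        exact hx.2.le.trans (ENNReal.toReal_le_of_le_ofReal hr.le h)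
      have hall : spreadBase μ f (spread μ f ⁻¹' Iic r) = spreadBase μ f univ := by
        refine measure_congr (Filter.eventuallyEq_univ.2 ?_)
        filter_upwards [ae_spreadBase hfm] with z hz
        refine (spread_mem_Icc hf hz.1 hz.2).2.trans (ENNReal.toReal_le_of_le_ofReal hr.le
          (le_trans ?_ h))
        exact measure_mono fun y hy => lt_of_lt_of_le hz.1 hy
      rw [hall, e, Real.volume_Ico, sub_zero, ENNReal.ofReal_toReal hfin, ← preimage_univ,
        ← Measure.map_apply measurable_fst MeasurableSet.univ, map_fst_spreadBase,
        Measure.restrict_apply_univ]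
      rfl
  have hle : ∀ r, 0 < r → halfLine.restrict {r | ENNReal.ofReal r < distribution μ f 0} (Iic r)
      ≤ ENNReal.ofReal r := fun r hr => by
    refine (Measure.restrict_apply_le _ _).trans ?_
    rw [Measure.restrict_apply' measurableSet_Ici, inter_comm, Ici_inter_Iic, Real.volume_Icc,
      sub_zero]
  have hzero : ∀ m : Measure ℝ, (∀ ε, 0 < ε → m (Iic ε) ≤ ENNReal.ofReal ε) →
      ∀ r ≤ 0, m (Iic r) = 0 := by
    intro m hm r hr
    refine le_antisymm (ENNReal.le_of_forall_pos_le_add fun ε hε _ => ?_) zero_le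
    rw [zero_add]
    refine (measure_mono (Iic_subset_Iic.2 (hr.trans ε.2))).trans ((hm ε hε).trans ?_)
    rw [ENNReal.ofReal_coe_nnreal]
  have hle' : ∀ r, 0 < r → (spreadBase μ f).map (spread μ f) (Iic r) ≤ ENNReal.ofReal r :=
    fun r hr => (hpos r hr).trans_le (hle r hr)
  refine ext_of_Iic_of_ne_top (fun r => ?_) fun r => ?_
  · rcases le_or_gt r 0 with h | h
    · rw [hzero _ hle' r h]; exact ENNReal.zero_ne_top
    · exact ne_top_of_le_ne_top ENNReal.ofReal_ne_top (hle' r h)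
  · rcases le_or_gt r 0 with h | h
    · rw [hzero _ hle' r h, hzero _ hle r h]
    · exact hpos r h

lemma rearrangement_eq_zero_of_distribution_le {r : ℝ}
    (h : distribution μ f 0 ≤ ENNReal.ofReal r) : rearrangement μ f r = 0 :=
  le_antisymm (rearrangement_le_of_distribution_le le_rfl h) (rearrangement_nonneg _ _ _)

/-- Composing the rearrangement with the spreading map recovers `f`: the composition is at most
`f`, and both have the same integral. -/
lemma rearrangement_spread_ae_eq [SigmaFinite μ] (hfm : Measurable f) (hf : Integrable f μ)
    (h0 : 0 ≤ᵐ[μ] f) :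
    ∀ᵐ z ∂spreadBase μ f, rearrangement μ f (spread μ f z) = f z.1 := by
  have hsp := measurable_spread (μ := μ) hfm
  have hsple : (spreadBase μ f).map (spread μ f) ≤ halfLine :=
    (map_spread hfm hf).le.trans Measure.restrict_le_self
  have hR := integrable_rearrangement hf
  have hle : ∀ᵐ z ∂spreadBase μ f, rearrangement μ f (spread μ f z) ≤ f z.1 := by
    filter_upwards [ae_spreadBase hfm] with z hz
    refine rearrangement_le_of_distribution_le hz.1.le ?_
    exact (ENNReal.le_ofReal_iff_toReal_le (distribution_ne_top hf hz.1)
      (ENNReal.toReal_nonneg.trans (spread_mem_Icc hf hz.1 hz.2).1)).2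
      (spread_mem_Icc hf hz.1 hz.2).1
  have hP : MeasurableSet {x | 0 < f x} := measurableSet_lt measurable_const hfm
  have hA : MeasurableSet {r : ℝ | ENNReal.ofReal r < distribution μ f 0} :=
    measurableSet_lt ENNReal.measurable_ofReal measurable_const
  have e1 : ∫⁻ z, ENNReal.ofReal (f z.1) ∂spreadBase μ f = ∫⁻ x, ENNReal.ofReal (f x) ∂μ := by
    rw [← lintegral_map hfm.ennreal_ofReal measurable_fst, map_fst_spreadBase,
      ← lintegral_indicator hP]
    refine lintegral_congr fun x => ?_
    by_cases hx : 0 < f x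
    · rw [indicator_of_mem (show x ∈ {x | 0 < f x} from hx)]
    · rw [indicator_of_notMem (by simpa using hx), ENNReal.ofReal_of_nonpos (not_lt.1 hx)]
  have e2 : ∫⁻ z, ENNReal.ofReal (rearrangement μ f (spread μ f z)) ∂spreadBase μ f
      = ∫⁻ r, ENNReal.ofReal (rearrangement μ f r) ∂halfLine := by
    rw [← lintegral_map' (f := fun r => ENNReal.ofReal (rearrangement μ f r))
      ((hR.1.aemeasurable.mono_measure hsple).ennreal_ofReal) hsp.aemeasurable,
      map_spread hfm hf, ← lintegral_indicator hA]
    refine lintegral_congr fun r => ?_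
    by_cases hr : ENNReal.ofReal r < distribution μ f 0
    · rw [indicator_of_mem (show r ∈ {r | ENNReal.ofReal r < distribution μ f 0} from hr)]
    · rw [indicator_of_notMem (by simpa using hr),
        rearrangement_eq_zero_of_distribution_le (not_lt.1 hr), ENNReal.ofReal_zero]
  have e3 : ∫⁻ r, ENNReal.ofReal (rearrangement μ f r) ∂halfLine
      = ∫⁻ x, ENNReal.ofReal (f x) ∂μ := by
    rw [← ofReal_integral_eq_lintegral_ofReal hR
        (Filter.Eventually.of_forall (rearrangement_nonneg μ f)),
      ← ofReal_integral_eq_lintegral_ofReal hf h0, integral_rearrangement hf h0]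
  have hfin : ∫⁻ x, ENNReal.ofReal (f x) ∂μ ≠ ∞ :=
    ((hasFiniteIntegral_iff_ofReal h0).1 hf.2).ne
  have hae := ae_eq_of_ae_le_of_lintegral_le
    (hle.mono fun z hz => ENNReal.ofReal_le_ofReal hz) (by rw [e2, e3]; exact hfin)
    (hfm.comp measurable_fst).ennreal_ofReal.aemeasurable (by rw [e1, e2, e3])
  filter_upwards [hae, ae_spreadBase hfm] with z hz hz'
  exact (ENNReal.ofReal_eq_ofReal_iff (rearrangement_nonneg _ _ _) hz'.1.le).1 hz

end Spread

/-- A function and its decreasing rearrangement are coupled on the set where their values agree,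
with marginals the restrictions of `μ` and of Lebesgue measure to the supports. -/
theorem exists_rearrangement_coupling {μ : Measure X} [SigmaFinite μ] {f : Lp ℝ 1 μ}
    (hf : 0 ≤ f) :
    ∃ (π : Measure (X × ℝ)) (A : Set ℝ), π.map Prod.fst = μ.restrict (supp f) ∧
      π.map Prod.snd = halfLine.restrict A ∧
      (∀ᵐ r ∂halfLine, r ∉ A → rearrangementL1 f r = 0) ∧
      ∀ᵐ z ∂π, f z.1 = rearrangementL1 f z.2 := by
  have hfm : Measurable f := (Lp.stronglyMeasurable f).measurable
  have hfi := L1.integrable_coeFn f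
  have h0 := (Lp.coeFn_nonneg f).2 hf
  have hsp := measurable_spread (μ := μ) hfm
  have hg : Measurable fun z : X × ℝ => (z.1, spread μ f z) := measurable_fst.prodMk hsp
  have hR : rearrangementL1 f =ᵐ[halfLine] rearrangement μ f := MemLp.coeFn_toLp _
  have hfst : ((spreadBase μ f).map fun z => (z.1, spread μ f z)).map Prod.fst
      = μ.restrict (supp f) := by
    rw [Measure.map_map measurable_fst hg]
    refine (map_fst_spreadBase (f := f)).trans (Measure.restrict_congr_set ?_)
    filter_upwards [h0] with x hx
    exact propext ⟨fun h => ne_of_gt h, fun h => lt_of_le_of_ne hx (Ne.symm h)⟩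
  have hsnd : ((spreadBase μ f).map fun z => (z.1, spread μ f z)).map Prod.snd
      = halfLine.restrict {r | ENNReal.ofReal r < distribution μ f 0} := by
    rw [Measure.map_map measurable_snd hg]
    exact map_spread hfm hfi
  refine ⟨_, _, hfst, hsnd, ?_, ?_⟩
  · filter_upwards [hR] with r hr hrA
    rw [hr]
    exact rearrangement_eq_zero_of_distribution_le (not_lt.1 hrA)
  · have hm : MeasurableSet {z : X × ℝ | f z.1 = rearrangementL1 f z.2} :=
      measurableSet_eq_fun (hfm.comp measurable_fst)
        ((Lp.stronglyMeasurable _).measurable.comp measurable_snd)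
    rw [ae_map_iff hg.aemeasurable hm]
    have hsple : (spreadBase μ f).map (spread μ f) ≤ halfLine :=
      (map_spread hfm hfi).le.trans Measure.restrict_le_self
    filter_upwards [rearrangement_spread_ae_eq hfm hfi h0, ae_comp_of_map_le hsp hsple hR]
      with z h1 h2
    rw [h2, h1]

/-! ### Operators realizing submajorization -/

namespace IsSubcoupling

variable {π : Measure (X × Y)} {μ : Measure X} {ν : Measure Y} [SigmaFinite ν]

lemma setLIntegral_onL1 [SigmaFinite μ] (hπ : IsSubcoupling π μ ν) {k : Lp ℝ 1 μ} (hk : 0 ≤ k)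
    {B : Set Y} (hB : MeasurableSet B) : ∫⁻ y in B, ENNReal.ofReal (hπ.dss.onL1 k y) ∂ν
      = ∫⁻ z in Prod.snd ⁻¹' B, ENNReal.ofReal (k z.1) ∂π := by
  have hk' := (Lp.coeFn_nonneg k).2 hk
  rw [← ofReal_integral_eq_lintegral_ofReal (L1.integrable_coeFn _).integrableOn
      (ae_restrict_of_ae ((Lp.coeFn_nonneg _).2 (hπ.dss.onL1_nonneg hk))),
    hπ.setIntegral_onL1 k hB, ofReal_integral_eq_lintegral_ofReal
      (integrable_comp_of_map_le measurable_fst hπ.fst_le (L1.integrable_coeFn k)).integrableOn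
      (ae_restrict_of_ae (ae_comp_of_map_le measurable_fst hπ.fst_le hk'))]

lemma op_one_le_chi (hπ : IsSubcoupling π μ ν) {A : Set Y} (hA : MeasurableSet A)
    (h : π.map Prod.snd ≤ ν.restrict A) : hπ.op (one μ) ≤ chi ν hA := by
  have hle : (fun y => ENNReal.ofReal (hπ.op (one μ) y)) ≤ᵐ[ν] A.indicator 1 := by
    refine ae_le_of_forall_setLIntegral_le_of_sigmaFinite
      (Lp.stronglyMeasurable _).measurable.ennreal_ofReal fun B hB _ => ?_
    rw [hπ.setLIntegral_op_one hB, setLIntegral_indicator hA, inter_comm]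
    refine (h B).trans ?_
    rw [Measure.restrict_apply hB]
    simp
  refine (Lp.coeFn_le _ _).1 ?_
  filter_upwards [hle, chi_ae_eq ν hA] with y h1 h2
  rw [h2]
  by_cases hy : y ∈ A
  · rw [indicator_of_mem hy] at h1 ⊢
    exact ENNReal.ofReal_le_one.1 h1
  · rw [indicator_of_notMem hy] at h1 ⊢
    exact ENNReal.ofReal_eq_zero.1 (le_antisymm h1 zero_le)

end IsSubcoupling

lemma measurable_indicator_of_antitoneOn {f : ℝ → ℝ} (hf : AntitoneOn f (Ioi 0))
    (h0 : ∀ x, 0 ≤ f x) : Measurable ((Ioi 0).indicator f) := by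
  refine measurable_of_Ioi fun c => ?_
  rcases lt_or_ge c 0 with hc | hc
  · have e : (Ioi 0).indicator f ⁻¹' Ioi c = univ :=
      eq_univ_of_forall fun x => hc.trans_le (indicator_nonneg (fun x _ => h0 x) x)
    rw [e]; exact MeasurableSet.univ
  · have e : (Ioi 0).indicator f ⁻¹' Ioi c = {x | 0 < x ∧ c < f x} := by
      ext x
      by_cases hx : 0 < x
      · simp [hx]
      · simp [hx, hc]
    rw [e]
    refine OrdConnected.measurableSet ⟨fun x hx y hy z hz => ?_⟩
    have hz0 : 0 < z := hx.1.trans_le hz.1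
    exact ⟨hz0, lt_of_lt_of_le hy.2 (hf hz0 hy.1 hz.2)⟩

lemma rearrangementL1_ae_eq {μ : Measure X} (f : Lp ℝ 1 μ) :
    rearrangementL1 f =ᵐ[halfLine] rearrangement μ f := MemLp.coeFn_toLp _

lemma rearrangementL1_nonneg {μ : Measure X} (f : Lp ℝ 1 μ) : 0 ≤ rearrangementL1 f :=
  (Lp.coeFn_nonneg _).1 ((rearrangementL1_ae_eq f).mono fun r hr => by
    rw [hr]; exact rearrangement_nonneg _ _ _)

/-- Submajorization of the rearrangements is realized by a doubly stochastic operator on the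
half-line, up to an excess. -/
lemma exists_halfLine_coupling {μ : Measure X} {ν : Measure Y} {f : Lp ℝ 1 μ} {g : Lp ℝ 1 ν}
    (hfg : Submajorizes f g) :
    ∃ (π : Measure (ℝ × ℝ)) (hπ : IsSubcoupling π halfLine halfLine),
      π.map Prod.fst = halfLine ∧ π.map Prod.snd = halfLine ∧
      rearrangementL1 g ≤ hπ.dss.onL1 (rearrangementL1 f) := by
  have hf := L1.integrable_coeFn f
  have hg := L1.integrable_coeFn g
  have hae : ∀ k : ℝ → ℝ, (Ioi 0).indicator k =ᵐ[halfLine] k := fun k => by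
    rw [halfLine_eq]
    filter_upwards [ae_restrict_mem measurableSet_Ioi] with x hx
    exact indicator_of_mem hx _
  have hIoc : ∀ (k : ℝ → ℝ) (t : ℝ), ∫ x in Ioc 0 t, (Ioi 0).indicator k x = ∫ x in Ioc 0 t, k x :=
    fun k t => setIntegral_congr_fun measurableSet_Ioc fun x hx =>
      indicator_of_mem (show x ∈ Ioi (0 : ℝ) from hx.1) _
  have hgm := measurable_indicator_of_antitoneOn (rearrangement_antitoneOn hg)
    (rearrangement_nonneg ν g)
  obtain ⟨π, h1, h2, h3⟩ := exists_exchange_coupling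
    (measurable_indicator_of_antitoneOn (rearrangement_antitoneOn hf) (rearrangement_nonneg μ f))
    hgm (fun x => indicator_nonneg (fun x _ => rearrangement_nonneg μ f x) x)
    (fun x => indicator_nonneg (fun x _ => rearrangement_nonneg ν g x) x)
    ((rearrangement_antitoneOn hg).congr fun x hx => (indicator_of_mem hx _).symm)
    ((integrable_rearrangement hf).congr (hae _).symm)
    ((integrable_rearrangement hg).congr (hae _).symm)
    (fun t ht => by
      rw [hIoc, hIoc, ← lorenz_eq_setIntegral _ _ ht.le, ← lorenz_eq_setIntegral _ _ ht.le]
      exact hfg t ht)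
  have hπ : IsSubcoupling π halfLine halfLine := ⟨h1.le, h2.le⟩
  refine ⟨π, hπ, h1, h2, (Lp.coeFn_le _ _).1 ?_⟩
  have hle : (fun x => ENNReal.ofReal ((Ioi 0).indicator (rearrangement ν g) x)) ≤ᵐ[halfLine]
      fun x => ENNReal.ofReal (hπ.dss.onL1 (rearrangementL1 f) x) := by
    refine ae_le_of_forall_setLIntegral_le_of_sigmaFinite hgm.ennreal_ofReal fun B hB _ => ?_
    rw [hπ.setLIntegral_onL1 (rearrangementL1_nonneg f) hB]
    refine (h3 B hB).trans_eq (lintegral_congr_ae (ae_restrict_of_ae ?_))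
    filter_upwards [ae_comp_of_map_le measurable_fst hπ.fst_le
      ((hae _).trans (rearrangementL1_ae_eq f).symm)] with z hz
    rw [hz]
  filter_upwards [hle, (hae _).trans (rearrangementL1_ae_eq g).symm,
    (Lp.coeFn_nonneg _).2 (hπ.dss.onL1_nonneg (rearrangementL1_nonneg f))] with x a1 a2 a3
  rw [a2] at a1
  exact (ENNReal.ofReal_le_ofReal_iff a3).1 a1

/-- Multiplication by `g / G ≤ 1` is doubly substochastic and maps `G` to `g`. -/
lemma exists_damping {ν : Measure Y} [SigmaFinite ν] {g G : Lp ℝ 1 ν} (hg : 0 ≤ g) (hgG : g ≤ G) :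
    ∃ (π : Measure (Y × Y)) (hπ : IsSubcoupling π ν ν), hπ.dss.onL1 G = g := by
  set w : Y → ℝ≥0∞ := fun y => ENNReal.ofReal (g y / G y) with hw
  have hgx := (Lp.coeFn_nonneg g).2 hg
  have hGx := (Lp.coeFn_le g G).2 hgG
  have hgm := (Lp.stronglyMeasurable g).measurable
  have hGm := (Lp.stronglyMeasurable G).measurable
  have hwm : Measurable w := (hgm.div hGm).ennreal_ofReal
  have hdiag : Measurable fun y : Y => (y, y) := measurable_id.prodMk measurable_id
  have hle : ν.withDensity w ≤ ν := by
    have h1 : w ≤ᵐ[ν] 1 := by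
      filter_upwards [hgx, hGx] with y h1 h2
      exact ENNReal.ofReal_le_one.2 (div_le_one_of_le₀ h2 (le_trans h1 h2))
    exact (withDensity_mono h1).trans_eq withDensity_one
  have hπ : IsSubcoupling ((ν.withDensity w).map fun y => (y, y)) ν ν := by
    constructor
    · rw [Measure.map_map measurable_fst hdiag]
      exact (Measure.map_id (μ := ν.withDensity w)).trans_le hle
    · rw [Measure.map_map measurable_snd hdiag]
      exact (Measure.map_id (μ := ν.withDensity w)).trans_le hle
  refine ⟨_, hπ, hπ.onL1_eq_of_setIntegral fun B hB => ?_⟩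
  refine (setIntegral_map (measurable_snd hB) (f := fun z : Y × Y => G z.1)
    (hGm.comp measurable_fst).aestronglyMeasurable hdiag.aemeasurable).trans ?_
  change ∫ y in B, G y ∂(ν.withDensity w) = _
  rw [restrict_withDensity hB, integral_withDensity_eq_integral_toReal_smul hwm
    (Filter.Eventually.of_forall fun _ => ENNReal.ofReal_lt_top)]
  refine integral_congr_ae (ae_restrict_of_ae ?_)
  filter_upwards [hgx, hGx] with y (h1 : 0 ≤ g y) h2
  simp only [hw, smul_eq_mul]
  rw [ENNReal.toReal_ofReal (div_nonneg h1 (h1.trans h2))]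
  rcases eq_or_ne (G y) 0 with h | h
  -- Where `G` vanishes so does `g`, so the convention `g / 0 = 0` does no harm.
  · rw [h, mul_zero]; exact le_antisymm h1 (h2.trans_eq h)
  · exact div_mul_cancel₀ _ h

/-- The operator from `X` to `Y` is composed of the coupling of `f` with its rearrangement, the
exchange coupling on the half-line, a damping, and the coupling of the rearrangement of `g`
with `g`. -/
theorem exists_dss_of_submajorizes {μ : Measure X} {ν : Measure Y} [SigmaFinite μ] [SigmaFinite ν]
    {f : Lp ℝ 1 μ} {g : Lp ℝ 1 ν} (hf : 0 ≤ f) (hg : 0 ≤ g) (hfg : Submajorizes f g) :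
    ∃ (T : DSS μ ν) (S : DSS ν μ), T.IsDual S ∧ T.onL1 f = g ∧
      T.op (one μ) ≤ chiSupp g ∧ S.op (one ν) ≤ chiSupp f := by
  obtain ⟨πf, A, f1, f2, f3, f4⟩ := exists_rearrangement_coupling hf
  obtain ⟨πg, B, g1, g2, g3, g4⟩ := exists_rearrangement_coupling hg
  obtain ⟨π, hπ, -, -, hle⟩ := exists_halfLine_coupling hfg
  obtain ⟨πd, hπd, hd⟩ := exists_damping (rearrangementL1_nonneg g) hle
  have hU : IsSubcoupling πf μ halfLine :=
    ⟨f1.le.trans Measure.restrict_le_self, f2.le.trans Measure.restrict_le_self⟩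
  have hV' : IsSubcoupling πg ν halfLine :=
    ⟨g1.le.trans Measure.restrict_le_self, g2.le.trans Measure.restrict_le_self⟩
  have hV := hV'.swap
  have hVsnd : (πg.map Prod.swap).map Prod.snd = ν.restrict (supp g) := by
    rw [Measure.map_map measurable_snd measurable_swap]; exact g1
  have hUsnd : (πf.map Prod.swap).map Prod.snd = μ.restrict (supp f) := by
    rw [Measure.map_map measurable_snd measurable_swap]; exact f1
  have hUf : hU.dss.onL1 f = rearrangementL1 f := hU.onL1_eq_of_ae_eq f4 f2 f3
  have hVg : hV.dss.onL1 (rearrangementL1 g) = g := by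
    refine hV.onL1_eq_of_ae_eq ?_ hVsnd (Filter.Eventually.of_forall fun y hy => not_not.1 hy)
    refine (ae_map_iff measurable_swap.aemeasurable (measurableSet_eq_fun
      ((Lp.stronglyMeasurable _).measurable.comp measurable_fst)
      ((Lp.stronglyMeasurable _).measurable.comp measurable_snd))).2 ?_
    filter_upwards [g4] with z hz using hz.symm
  refine ⟨hV.dss.comp (hπd.dss.comp (hπ.dss.comp hU.dss)),
    ((hU.swap.dss.comp hπ.swap.dss).comp hπd.swap.dss).comp hV.swap.dss,
    hV.isDual_dss.comp (hπd.isDual_dss.comp (hπ.isDual_dss.comp hU.isDual_dss)), ?_, ?_, ?_⟩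
  · rw [DSS.onL1_comp, DSS.onL1_comp, DSS.onL1_comp, hUf, hd, hVg]
  · exact (hV.dss.op_mono (hπd.dss.comp (hπ.dss.comp hU.dss)).subunital).trans
      (hV.op_one_le_chi _ hVsnd.le)
  · exact (hU.swap.dss.op_mono (hπ.swap.dss.comp (hπd.swap.dss.comp hV.swap.dss)).subunital).trans
      (hU.swap.op_one_le_chi _ hUsnd.le)

lemma chi_le_one (μ : Measure X) {A : Set X} (hA : MeasurableSet A) : chi μ hA ≤ one μ := by
  refine (Lp.coeFn_le _ _).1 ?_
  filter_upwards [chi_ae_eq μ hA, one_ae_eq μ] with x h1 h2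
  rw [h1, h2]
  exact indicator_le_self' (fun _ _ => zero_le_one) x

lemma chi_nonneg (μ : Measure X) {A : Set X} (hA : MeasurableSet A) : 0 ≤ chi μ hA := by
  refine (Lp.coeFn_nonneg _).1 ?_
  filter_upwards [chi_ae_eq μ hA] with x h1
  rw [h1]
  exact indicator_nonneg (fun _ _ => zero_le_one) x

/-! ### Majorization -/

/-- If `f` and `T f = g` have the same integral, then `T*(χ_{supp g}) = 1` on the support of `f`,
since `∫ f T*(χ_{supp g}) = ∫ g = ∫ f`. -/
lemma DSS.dual_chiSupp_eq {μ : Measure X} {ν : Measure Y} {T : DSS μ ν} {S : DSS ν μ}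
    (hTS : T.IsDual S) {f : Lp ℝ 1 μ} {g : Lp ℝ 1 ν} (hf : 0 ≤ f) (hT : T.onL1 f = g)
    (hint : ∫ x, f x ∂μ = ∫ y, g y ∂ν) (hS : S.op (chiSupp g) ≤ chiSupp f) :
    S.op (chiSupp g) = chiSupp f := by
  set s := S.op (chiSupp g) with hs
  have hfi := L1.integrable_coeFn f
  have hfx := (Lp.coeFn_nonneg f).2 hf
  have hs0 := (Lp.coeFn_nonneg s).2 (S.positive _ (chi_nonneg ν (measurableSet_supp g)))
  have hs1 := (Lp.coeFn_le _ _).2 hS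
  have hcf := chi_ae_eq μ (measurableSet_supp f)
  have e1 : ∫ x, s x * f x ∂μ = ∫ x, f x ∂μ := by
    rw [hs, ← hTS f (chiSupp g), hT, hint]
    refine integral_congr_ae ?_
    filter_upwards [chi_ae_eq ν (measurableSet_supp g)] with y hy
    change chi ν (measurableSet_supp g) y * g y = g y
    rw [hy]
    by_cases h : y ∈ supp g
    · rw [indicator_of_mem h, one_mul]
    · rw [indicator_of_notMem h, zero_mul]; exact (not_not.1 h).symm
  have hsi : Integrable (fun x => s x * f x) μ :=
    hfi.bdd_mul (Lp.aestronglyMeasurable s) (Linfty_ae_bound s)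
  have hle : ∀ᵐ x ∂μ, s x * f x ≤ f x := by
    filter_upwards [hs1, hcf, hfx] with x h1 h2 h3
    refine mul_le_of_le_one_left h3 (h1.trans ?_)
    exact h2.le.trans (indicator_le_self' (fun _ _ => zero_le_one) x)
  have hz : ∀ᵐ x ∂μ, f x - s x * f x = 0 := by
    have h0 := (integral_eq_zero_iff_of_nonneg_ae (hle.mono fun x hx => sub_nonneg.2 hx)
      (hfi.sub hsi)).1 (by rw [integral_sub hfi hsi, e1, sub_self])
    exact h0
  refine Lp.ext ?_
  filter_upwards [hs0, hs1, hcf, hz] with x h0 h1 h2 h3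
  change chiSupp f x = _ at h2
  rw [h2] at h1 ⊢
  by_cases h : x ∈ supp f
  · rw [indicator_of_mem h]
    have hne : f x ≠ 0 := h
    have : (1 - s x) * f x = 0 := by linarith
    rcases mul_eq_zero.1 this with h' | h'
    · linarith
    · exact absurd h' hne
  · rw [indicator_of_notMem h] at h1 ⊢
    exact le_antisymm h1 h0

lemma lintegral_chi (μ : Measure X) {A : Set X} (hA : MeasurableSet A) :
    ∫⁻ x, ENNReal.ofReal (chi μ hA x) ∂μ = μ A := by
  rw [← lintegral_indicator_one hA]
  refine lintegral_congr_ae ?_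
  filter_upwards [chi_ae_eq μ hA] with x hx
  rw [hx]
  by_cases h : x ∈ A <;> simp [h]

/-- Apply the integral inequality of `S` to `χ_{supp g}`. -/
lemma measure_supp_le {μ : Measure X} {ν : Measure Y} {S : DSS ν μ} {f : Lp ℝ 1 μ} {g : Lp ℝ 1 ν}
    (hS : S.op (chiSupp g) = chiSupp f) : μ (supp f) ≤ ν (supp g) := by
  by_cases htop : ν (supp g) = ∞
  · rw [htop]; exact le_top
  have hi : Integrable (chiSupp g) ν := by
    refine (integrable_congr (chi_ae_eq ν (measurableSet_supp g))).2 ?_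
    exact (integrable_indicator_iff (measurableSet_supp g)).2 (integrableOn_const htop)
  have h := S.integral_le _ (chi_nonneg ν (measurableSet_supp g)) hi
  rw [lintegral_chi ν (measurableSet_supp g)] at h
  refine le_trans (le_of_eq ?_) h
  change _ = ∫⁻ x, ENNReal.ofReal (S.op (chiSupp g) x) ∂μ
  rw [hS]
  exact (lintegral_chi μ (measurableSet_supp f)).symm

/-- The operator of the exchange coupling maps `f↓` to a function that is at least `g↓`. When the
integrals of `f` and `g` agree, so do those of the two functions, which are therefore equal. -/
lemma exists_ds_rearrangement {μ : Measure X} {ν : Measure Y} {f : Lp ℝ 1 μ} {g : Lp ℝ 1 ν}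
    (hf : 0 ≤ f) (hg : 0 ≤ g) (hfg : Majorizes f g) :
    ∃ S : DSS halfLine halfLine, S.IsDS ∧ S.onL1 (rearrangementL1 f) = rearrangementL1 g := by
  obtain ⟨π, hπ, h1, h2, hle⟩ := exists_halfLine_coupling hfg.1
  refine ⟨hπ.dss, hπ.isDS_dss h1 h2, ?_⟩
  have ef : ∫ r, rearrangementL1 f r ∂halfLine = ∫ z, f z ∂μ := by
    rw [integral_congr_ae (rearrangementL1_ae_eq f)]
    exact integral_rearrangement (L1.integrable_coeFn f) ((Lp.coeFn_nonneg f).2 hf)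
  have eg : ∫ r, rearrangementL1 g r ∂halfLine = ∫ z, g z ∂ν := by
    rw [integral_congr_ae (rearrangementL1_ae_eq g)]
    exact integral_rearrangement (L1.integrable_coeFn g) ((Lp.coeFn_nonneg g).2 hg)
  have hle' := (Lp.coeFn_le _ _).2 hle
  have hI := hπ.dss.integral_onL1_le (rearrangementL1_nonneg f)
  rw [ef, hfg.2, ← eg] at hI
  have hi1 := L1.integrable_coeFn (rearrangementL1 g)
  have hi2 := L1.integrable_coeFn (hπ.dss.onL1 (rearrangementL1 f))
  have heq := (integral_eq_iff_of_ae_le hi1 hi2 hle').1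
    (le_antisymm (integral_mono_ae hi1 hi2 hle') hI)
  exact (Lp.ext heq).symm

/-- Rearrangements have the same excess integrals, so a substochastic operator between
rearrangements gives the excess inequalities for the functions themselves. -/
lemma integral_max_sub_le_of_rearrangement {μ : Measure X} {ν : Measure Y} {f : Lp ℝ 1 μ}
    {g : Lp ℝ 1 ν} {S : DSS halfLine halfLine}
    (hS : S.onL1 (rearrangementL1 f) = rearrangementL1 g) {t : ℝ} (ht : 0 ≤ t) :
    ∫ y, max (g y - t) 0 ∂ν ≤ ∫ x, max (f x - t) 0 ∂μ := by
  have h := integral_max_sub_le_of_convex (f := rearrangementL1 f) (g := rearrangementL1 g)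
    (fun φ h1 h2 h3 => hS ▸ S.lintegral_convex_le (rearrangementL1_nonneg f) h1 h2 h3) ht
  have ef : ∫ r, max (rearrangementL1 f r - t) 0 ∂halfLine
      = ∫ r, max (rearrangement μ f r - t) 0 ∂halfLine :=
    integral_congr_ae ((rearrangementL1_ae_eq f).mono fun r hr => by simp only [hr])
  have eg : ∫ r, max (rearrangementL1 g r - t) 0 ∂halfLine
      = ∫ r, max (rearrangement ν g r - t) 0 ∂halfLine :=
    integral_congr_ae ((rearrangementL1_ae_eq g).mono fun r hr => by simp only [hr])
  rwa [ef, eg, integral_rearrangement_max_sub (L1.integrable_coeFn f) ht,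
    integral_rearrangement_max_sub (L1.integrable_coeFn g) ht] at h

/-! ### Completion to a doubly stochastic operator -/

lemma lintegral_ofReal_add {ν : Measure Y} {a b : Lp ℝ ∞ ν} (ha : 0 ≤ a) (hb : 0 ≤ b) :
    ∫⁻ y, ENNReal.ofReal ((a + b : Lp ℝ ∞ ν) y) ∂ν
      = ∫⁻ y, ENNReal.ofReal (a y) ∂ν + ∫⁻ y, ENNReal.ofReal (b y) ∂ν := by
  rw [← lintegral_add_right _ (Lp.stronglyMeasurable b).measurable.ennreal_ofReal]
  refine lintegral_congr_ae ?_
  filter_upwards [Lp.coeFn_add a b, (Lp.coeFn_nonneg a).2 ha, (Lp.coeFn_nonneg b).2 hb]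
    with y h1 h2 h3
  rw [h1, Pi.add_apply, ENNReal.ofReal_add h2 h3]

/-- The sum of two doubly substochastic operators, when it is doubly substochastic. -/
def DSS.add {μ : Measure X} {ν : Measure Y} (T R : DSS μ ν)
    (h1 : T.op (one μ) + R.op (one μ) ≤ one ν)
    (h2 : ∀ h : Lp ℝ ∞ μ, 0 ≤ h → Integrable h μ →
      ∫⁻ y, ENNReal.ofReal (T.op h y) ∂ν + ∫⁻ y, ENNReal.ofReal (R.op h y) ∂ν
        ≤ ∫⁻ x, ENNReal.ofReal (h x) ∂μ) : DSS μ ν where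
  op := T.op + R.op
  positive h h0 := add_nonneg (T.positive h h0) (R.positive h h0)
  weakStar_continuous := by
    refine continuous_induced_rng.2 (@continuous_pi _ _ _ (weakStar μ) _ _ fun k => ?_)
    have hc : ∀ T : DSS μ ν, @Continuous _ _ (weakStar μ) _
        fun h : Lp ℝ ∞ μ => ∫ y, T.op h y * k y ∂ν := fun T => by
      have hd : @Continuous _ _ (weakStar ν) _
          fun (h : Lp ℝ ∞ ν) (k : Lp ℝ 1 ν) => ∫ x, h x * k x ∂ν := continuous_induced_dom
      exact @Continuous.comp _ _ _ (weakStar μ) (weakStar ν) _ _ _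
        ((@continuous_pi_iff _ _ _ (weakStar ν) _ _).1 hd k) T.weakStar_continuous
    have e : (fun h : Lp ℝ ∞ μ => ∫ y, (T.op + R.op) h y * k y ∂ν)
        = fun h => ∫ y, T.op h y * k y ∂ν + ∫ y, R.op h y * k y ∂ν := by
      funext h
      rw [← integral_add
        ((L1.integrable_coeFn k).bdd_mul (Lp.aestronglyMeasurable _) (Linfty_ae_bound _))
        ((L1.integrable_coeFn k).bdd_mul (Lp.aestronglyMeasurable _) (Linfty_ae_bound _))]
      refine integral_congr_ae ?_
      filter_upwards [Lp.coeFn_add (T.op h) (R.op h)] with y hy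
      rw [LinearMap.add_apply, hy, Pi.add_apply, add_mul]
    change @Continuous _ _ (weakStar μ) _ (fun h : Lp ℝ ∞ μ => ∫ y, (T.op + R.op) h y * k y ∂ν)
    rw [e]
    exact @Continuous.add _ _ _ _ _ (weakStar μ) _ _ (hc T) (hc R)
  subunital := h1
  integral_le h h0 hi := by
    refine le_trans (le_of_eq ?_) (h2 h h0 hi)
    exact lintegral_ofReal_add (T.positive h h0) (R.positive h h0)

lemma DSS.op_one_nonneg {μ : Measure X} {ν : Measure Y} (T : DSS μ ν) : 0 ≤ T.op (one μ) :=
  T.positive _ (chi_nonneg μ _)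

section Completion

variable {μ : Measure X} {ν : Measure Y}

/-- The integral of `T h` is that of `T*(1) h`, by duality with the constant function `1`. -/
lemma DSS.lintegral_op_eq {T : DSS μ ν} {S : DSS ν μ} (hTS : T.IsDual S) {h : Lp ℝ ∞ μ}
    (h0 : 0 ≤ h) (hi : Integrable h μ) :
    ∫⁻ y, ENNReal.ofReal (T.op h y) ∂ν
      = ∫⁻ x, ENNReal.ofReal (S.op (one ν) x) * ENNReal.ofReal (h x) ∂μ := by
  have hk : h =ᵐ[μ] hi.toL1 h := hi.coeFn_toL1.symm
  have e := hTS (hi.toL1 h) (one ν)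
  have e1 : ∫ y, one ν y * T.onL1 (hi.toL1 h) y ∂ν = ∫ y, T.op h y ∂ν := by
    refine integral_congr_ae ?_
    filter_upwards [one_ae_eq ν, T.onL1_ae_eq h _ hk] with y h1 h2
    rw [h1, h2, one_mul]
  have e2 : ∫ x, S.op (one ν) x * hi.toL1 h x ∂μ = ∫ x, S.op (one ν) x * h x ∂μ :=
    integral_congr_ae (hk.mono fun x hx => by simp only [hx])
  have hS0 := (Lp.coeFn_nonneg _).2 S.op_one_nonneg
  have hh0 := (Lp.coeFn_nonneg _).2 h0
  rw [← ofReal_integral_eq_lintegral_ofReal (T.integrable_op ⟨h, hi⟩)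
    ((Lp.coeFn_nonneg _).2 (T.positive h h0)), ← e1, e, e2, ofReal_integral_eq_lintegral_ofReal
    (hi.bdd_mul (Lp.aestronglyMeasurable _) (Linfty_ae_bound _))
    (by filter_upwards [hS0, hh0] with x h1 h2 using mul_nonneg h1 h2)]
  refine lintegral_congr_ae ?_
  filter_upwards [hS0] with x h1
  exact ENNReal.ofReal_mul h1

/-- On finite measure spaces of equal mass, a dual pair of doubly substochastic operators is
completed to a doubly stochastic operator by adding the operator of rank one formed from the
defects `1 - T*(1)` and `1 - T(1)`. The added operator does not see `f` when `T*(1) = 1` on the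
support of `f`. -/
theorem exists_ds_completion [IsFiniteMeasure μ] [IsFiniteMeasure ν]
    (hmass : μ univ = ν univ) {T : DSS μ ν} {S : DSS ν μ} (hTS : T.IsDual S) {f : Lp ℝ 1 μ}
    (hSf : chiSupp f ≤ S.op (one ν)) :
    ∃ T' : DSS μ ν, T'.IsDS ∧ T'.onL1 f = T.onL1 f := by
  set p : Lp ℝ ∞ ν := one ν - T.op (one μ) with hp
  set q : Lp ℝ ∞ μ := one μ - S.op (one ν) with hq
  have hp0 : 0 ≤ p := sub_nonneg.2 T.subunital
  have hq0 : 0 ≤ q := sub_nonneg.2 S.subunital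
  have h1i : Integrable (one μ) μ := (integrable_congr (one_ae_eq μ)).2 (integrable_const _)
  have hpm := (Lp.stronglyMeasurable p).measurable.ennreal_ofReal
  have hqm := (Lp.stronglyMeasurable q).measurable.ennreal_ofReal
  set P := ν.withDensity fun y => ENNReal.ofReal (p y) with hP
  set Q := μ.withDensity fun x => ENNReal.ofReal (q x) with hQ
  have hPν : P ≤ ν := by
    refine (withDensity_mono ?_).trans_eq withDensity_one
    filter_upwards [(Lp.coeFn_le _ _).2 (sub_le_self (one ν) T.op_one_nonneg), one_ae_eq ν]
      with y h1 h2
    exact ENNReal.ofReal_le_one.2 (h1.trans_eq h2)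
  have hQμ : Q ≤ μ := by
    refine (withDensity_mono ?_).trans_eq withDensity_one
    filter_upwards [(Lp.coeFn_le _ _).2 (sub_le_self (one μ) S.op_one_nonneg), one_ae_eq μ]
      with y h1 h2
    exact ENNReal.ofReal_le_one.2 (h1.trans_eq h2)
  have : IsFiniteMeasure P := isFiniteMeasure_of_le ν hPν
  have : IsFiniteMeasure Q := isFiniteMeasure_of_le μ hQμ
  -- Both defects have the same mass, since `T 1` and `T* 1` have the same integral.
  have hmass' : P univ = Q univ := by
    have hTS1 : ∫⁻ y, ENNReal.ofReal (T.op (one μ) y) ∂ν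
        = ∫⁻ x, ENNReal.ofReal (S.op (one ν) x) ∂μ := by
      refine (DSS.lintegral_op_eq hTS (h := one μ) (chi_nonneg μ _) h1i).trans
        (lintegral_congr_ae ?_)
      filter_upwards [one_ae_eq μ] with x hx
      rw [hx, ENNReal.ofReal_one, mul_one]
    have a1 : ∫⁻ y, ENNReal.ofReal (p y) ∂ν + ∫⁻ y, ENNReal.ofReal (T.op (one μ) y) ∂ν
        = ν univ := by
      rw [← lintegral_ofReal_add hp0 T.op_one_nonneg, hp, sub_add_cancel]
      exact lintegral_chi ν _
    have a2 : ∫⁻ x, ENNReal.ofReal (q x) ∂μ + ∫⁻ x, ENNReal.ofReal (S.op (one ν) x) ∂μ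
        = μ univ := by
      rw [← lintegral_ofReal_add hq0 S.op_one_nonneg, hq, sub_add_cancel]
      exact lintegral_chi μ _
    rw [hP, hQ, withDensity_apply _ MeasurableSet.univ, withDensity_apply _ MeasurableSet.univ,
      setLIntegral_univ, setLIntegral_univ]
    have hfin : ∫⁻ x, ENNReal.ofReal (S.op (one ν) x) ∂μ ≠ ∞ :=
      ne_top_of_le_ne_top (measure_ne_top μ univ) (le_add_self.trans_eq a2)
    rw [hTS1, ← hmass, ← a2] at a1
    exact (ENNReal.add_left_inj hfin).1 a1
  -- If `m = 0` then both defects vanish, and so does the product measure with its factor `m⁻¹ = ∞`.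
  set m := Q univ
  have hfst : (m⁻¹ • Q.prod P).map Prod.fst = Q := by
    rw [Measure.map_smul, Measure.map_fst_prod, hmass', smul_smul]
    rcases eq_or_ne m 0 with h | h
    · have : Q = 0 := Measure.measure_univ_eq_zero.1 h
      rw [this, smul_zero]
    · rw [ENNReal.inv_mul_cancel h (measure_ne_top _ _), one_smul]
  have hsnd : (m⁻¹ • Q.prod P).map Prod.snd = P := by
    rw [Measure.map_smul, Measure.map_snd_prod, smul_smul]
    rcases eq_or_ne m 0 with h | h
    · have : P = 0 := Measure.measure_univ_eq_zero.1 (hmass'.trans h)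
      rw [this, smul_zero]
    · rw [ENNReal.inv_mul_cancel h (measure_ne_top _ _), one_smul]
  have hπ : IsSubcoupling (m⁻¹ • Q.prod P) μ ν := ⟨hfst.trans_le hQμ, hsnd.trans_le hPν⟩
  have hR1 : hπ.op (one μ) = p := by
    have hae : (fun y => ENNReal.ofReal (hπ.op (one μ) y)) =ᵐ[ν] fun y => ENNReal.ofReal (p y) := by
      refine ae_eq_of_forall_setLIntegral_eq_of_sigmaFinite
        (Lp.stronglyMeasurable _).measurable.ennreal_ofReal hpm fun B hB _ => ?_
      rw [hπ.setLIntegral_op_one hB, hsnd, hP, withDensity_apply _ hB]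
    refine Lp.ext ?_
    filter_upwards [hae, (Lp.coeFn_nonneg _).2 hp0,
      (Lp.coeFn_nonneg _).2 (hπ.op_nonneg_and_setLIntegral (chi_nonneg μ MeasurableSet.univ)).1]
      with y h1 h2 h3
    exact (ENNReal.ofReal_eq_ofReal_iff h3 h2).1 h1
  have hunit : T.op (one μ) + hπ.dss.op (one μ) = one ν := by
    change T.op (one μ) + hπ.op (one μ) = one ν
    rw [hR1, hp, add_sub_cancel]
  have hint : ∀ h : Lp ℝ ∞ μ, 0 ≤ h → Integrable h μ →
      ∫⁻ y, ENNReal.ofReal (T.op h y) ∂ν + ∫⁻ y, ENNReal.ofReal (hπ.dss.op h y) ∂ν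
        = ∫⁻ x, ENNReal.ofReal (h x) ∂μ := by
    intro h h0 hi
    have e1 : ∫⁻ y, ENNReal.ofReal (hπ.dss.op h y) ∂ν
        = ∫⁻ x, ENNReal.ofReal (q x) * ENNReal.ofReal (h x) ∂μ := by
      refine (hπ.lintegral_op h0).trans ?_
      rw [hfst, hQ, lintegral_withDensity_eq_lintegral_mul _ hqm
        (Lp.stronglyMeasurable h).measurable.ennreal_ofReal]
      rfl
    rw [DSS.lintegral_op_eq hTS h0 hi, e1, ← lintegral_add_right
      (g := fun x => ENNReal.ofReal (q x) * ENNReal.ofReal (h x)) _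
      (hqm.mul (Lp.stronglyMeasurable h).measurable.ennreal_ofReal)]
    refine lintegral_congr_ae ?_
    filter_upwards [Lp.coeFn_sub (one μ) (S.op (one ν)), one_ae_eq μ, (Lp.coeFn_nonneg _).2 hq0,
      (Lp.coeFn_nonneg _).2 S.op_one_nonneg] with x a1 a2 a3 a4
    rw [Pi.sub_apply, a2] at a1
    rw [← add_mul, ← ENNReal.ofReal_add a4 a3, hq, a1, add_sub_cancel, ENNReal.ofReal_one, one_mul]
  refine ⟨T.add hπ.dss hunit.le fun h h0 hi => (hint h h0 hi).le, ⟨hunit, fun h h0 hi => ?_⟩, ?_⟩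
  · exact (lintegral_ofReal_add (T.positive h h0) (hπ.dss.positive h h0)).trans (hint h h0 hi)
  · have hadd : T.onL1 + hπ.dss.onL1
        = (T.add hπ.dss hunit.le fun h h0 hi => (hint h h0 hi).le).onL1 := by
      refine DSS.onL1_unique _ _ fun h k hk => ?_
      filter_upwards [Lp.coeFn_add (T.onL1 k) (hπ.dss.onL1 k), T.onL1_ae_eq h k hk,
        hπ.dss.onL1_ae_eq h k hk, Lp.coeFn_add (T.op h) (hπ.dss.op h)] with y a1 a2 a3 a4
      change (T.onL1 k + hπ.dss.onL1 k : Lp ℝ 1 ν) y = (T.op h + hπ.dss.op h : Lp ℝ ∞ ν) y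
      rw [a1, a4, Pi.add_apply, Pi.add_apply, a2, a3]
    have hzero : hπ.dss.onL1 f = 0 := by
      refine hπ.onL1_eq_of_setIntegral fun B hB => ?_
      have hfQ : ∀ᵐ x ∂Q, f x = 0 := by
        rw [hQ, ae_withDensity_iff hqm]
        filter_upwards [(Lp.coeFn_le _ _).2 hSf, chi_ae_eq μ (measurableSet_supp f),
          Lp.coeFn_sub (one μ) (S.op (one ν)), one_ae_eq μ] with x a1 a2 a3 a4 hne
        by_contra hfx
        refine hne (ENNReal.ofReal_of_nonpos ?_)
        change chiSupp f x = _ at a2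
        rw [a2, indicator_of_mem (show x ∈ supp f from hfx)] at a1
        rw [hq, a3, Pi.sub_apply, a4]
        linarith
      have e1 : ∫ z in Prod.snd ⁻¹' B, f z.1 ∂(m⁻¹ • Q.prod P) = 0 := by
        refine integral_eq_zero_of_ae (ae_restrict_of_ae ?_)
        exact ae_comp_of_map_le measurable_fst hfst.le hfQ
      have e2 : ∫ y in B, (0 : Lp ℝ 1 ν) y ∂ν = 0 :=
        integral_eq_zero_of_ae (ae_restrict_of_ae (Lp.coeFn_zero ℝ 1 ν))
      rw [e1, e2]
    rw [← hadd, add_apply, hzero, add_zero]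

end Completion

end Majorization

end

open Majorization
theorem mainTheorem12 {X Y : Type*} [MeasurableSpace X] [MeasurableSpace Y]
    (μ : Measure X) (ν : Measure Y) [SigmaFinite μ] [SigmaFinite ν]
    (f : Lp ℝ 1 μ) (g : Lp ℝ 1 ν) (hf : 0 ≤ f) (hg : 0 ≤ g) :
    -- submajorization
    ([Submajorizes f g,
      ∀ φ : ℝ → ℝ, ConvexOn ℝ (Ici 0) φ → (∀ x, 0 ≤ x → 0 ≤ φ x) → φ 0 = 0 →
        ∫⁻ y, ENNReal.ofReal (φ (g y)) ∂ν ≤ ∫⁻ x, ENNReal.ofReal (φ (f x)) ∂μ,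
      ∀ t : ℝ, 0 ≤ t → ∫ y, max (g y - t) 0 ∂ν ≤ ∫ x, max (f x - t) 0 ∂μ,
      ∃ T : DSS μ ν, T.onL1 f = g].TFAE ∧
      (Submajorizes f g → ∃ (T : DSS μ ν) (S : DSS ν μ), T.IsDual S ∧ T.onL1 f = g ∧
        T.op (chiSupp f) ≤ chiSupp g ∧ S.op (chiSupp g) ≤ chiSupp f)) ∧
    -- majorization
    (∫ x, f x ∂μ = ∫ y, g y ∂ν →
      [Majorizes f g,
        ∀ φ : ℝ → ℝ, ConvexOn ℝ (Ici 0) φ → (∀ x, 0 ≤ x → 0 ≤ φ x) → φ 0 = 0 →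
          ∫⁻ y, ENNReal.ofReal (φ (g y)) ∂ν ≤ ∫⁻ x, ENNReal.ofReal (φ (f x)) ∂μ,
        ∀ t : ℝ, 0 ≤ t → ∫ y, max (g y - t) 0 ∂ν ≤ ∫ x, max (f x - t) 0 ∂μ,
        ∃ S : DSS halfLine halfLine, S.IsDS ∧ S.onL1 (rearrangementL1 f) = rearrangementL1 g,
        ∃ (T : DSS μ ν) (S : DSS ν μ), T.IsDual S ∧ T.onL1 f = g ∧
          T.op (chiSupp f) ≤ chiSupp g ∧ S.op (chiSupp g) = chiSupp f].TFAE ∧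
      (Majorizes f g → μ (supp f) ≤ ν (supp g)) ∧
      (μ univ = ν univ → μ univ < ∞ →
        (Majorizes f g ↔ ∃ T : DSS μ ν, T.IsDS ∧ T.onL1 f = g))) := by
  have hcd : ∀ T : DSS μ ν, T.onL1 f = g →
      ∀ φ : ℝ → ℝ, ConvexOn ℝ (Ici 0) φ → (∀ x, 0 ≤ x → 0 ≤ φ x) → φ 0 = 0 →
        ∫⁻ y, ENNReal.ofReal (φ (g y)) ∂ν ≤ ∫⁻ x, ENNReal.ofReal (φ (f x)) ∂μ :=
    fun T hT φ h1 h2 h3 => hT ▸ T.lintegral_convex_le hf h1 h2 h3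
  have hsub : ∀ T : DSS μ ν, T.onL1 f = g → Submajorizes f g := fun T hT =>
    submajorizes_of_integral_max_sub_le fun t ht => integral_max_sub_le_of_convex (hcd T hT) ht
  have hex : Submajorizes f g → ∃ (T : DSS μ ν) (S : DSS ν μ), T.IsDual S ∧ T.onL1 f = g ∧
      T.op (chiSupp f) ≤ chiSupp g ∧ S.op (chiSupp g) ≤ chiSupp f := fun h => by
    obtain ⟨T, S, hTS, hT, h1, h2⟩ := exists_dss_of_submajorizes hf hg h
    exact ⟨T, S, hTS, hT, (T.op_mono (chi_le_one μ _)).trans h1,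
      (S.op_mono (chi_le_one ν _)).trans h2⟩
  refine ⟨⟨?_, hex⟩, fun hint => ?_⟩
  · tfae_have 1 → 4 := fun h => let ⟨T, _, _, hT, _⟩ := hex h; ⟨T, hT⟩
    tfae_have 4 → 2 := fun ⟨T, hT⟩ => hcd T hT
    tfae_have 2 → 3 := fun h t ht => integral_max_sub_le_of_convex h ht
    tfae_have 3 → 1 := fun h => submajorizes_of_integral_max_sub_le h
    tfae_finish
  have hexm : Majorizes f g → ∃ (T : DSS μ ν) (S : DSS ν μ), T.IsDual S ∧ T.onL1 f = g ∧
      T.op (chiSupp f) ≤ chiSupp g ∧ S.op (chiSupp g) = chiSupp f := fun h => by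
    obtain ⟨T, S, hTS, hT, h1, h2⟩ := hex h.1
    exact ⟨T, S, hTS, hT, h1, DSS.dual_chiSupp_eq hTS hf hT hint h2⟩
  refine ⟨?_, fun h => ?_, fun hmass hfin => ⟨fun h => ?_, fun ⟨T, _, hT⟩ => ⟨hsub T hT, hint⟩⟩⟩
  · tfae_have 1 → 5 := hexm
    tfae_have 5 → 2 := fun ⟨T, _, _, hT, _⟩ => hcd T hT
    tfae_have 2 → 3 := fun h t ht => integral_max_sub_le_of_convex h ht
    tfae_have 3 → 1 := fun h => ⟨submajorizes_of_integral_max_sub_le h, hint⟩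
    tfae_have 1 → 4 := exists_ds_rearrangement hf hg
    tfae_have 4 → 3 := fun ⟨S, _, hS⟩ t ht => integral_max_sub_le_of_rearrangement hS ht
    tfae_finish
  · obtain ⟨T, S, _, _, _, h5⟩ := hexm h
    exact measure_supp_le h5
  · obtain ⟨T, S, hTS, hT, _, h5⟩ := hexm h
    have : IsFiniteMeasure μ := ⟨hfin⟩
    have : IsFiniteMeasure ν := ⟨hmass ▸ hfin⟩
    obtain ⟨T', hDS, hT'⟩ := exists_ds_completion hmass hTS
      (f := f) (h5.symm.trans_le (S.op_mono (chi_le_one ν _)))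
    exact ⟨T', hDS, hT'.trans hT⟩
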